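/- Let $\Omega\subseteq\mathbb{R}^3$ be open, let $T>0$, and let $\beta:\Omega\to\mathbb{R}$ be measurable with $0<\beta_0\le\beta(x)\le\beta_M$ for almost every $x\in\Omega$. Write $(\cdot,\cdot)$ for the scalar product of $L^2(\Omega)^3$. Let $V=H_0(\mathrm{curl};\Omega)$ be the space of all $A\in L^2(\Omega)^3$ with distributional curl $\nabla\times A\in L^2(\Omega)^3$ and $n\times A=0$ on $\partial\Omega$, where the boundary condition means that $(\nabla\times A,\varphi)=(A,\nabla\times\varphi)$ for all $\varphi\in H^1(\Omega)^3$ (for a bounded Lipschitz domain this is the vanishing of the tangential trace of $A$). It carries the graph norm $\|A\|_V^2=\|A\|_{L^2}^2+\|\nabla\times A\|_{L^2}^2$. Let $V'$ be its dual, with $L^2(\Omega)^3\to V'$ given by $g\mapsto (g,\cdot)$. Consider the problem $$\partial_t B+\nabla\times(\beta\,\nabla\times B)=F\ \text{ in }\Omega\times(0,T),\qquad n\times B=0\ \text{ on }\partial\Omega\times(0,T),\qquad B(0)=B_0\ \text{ in }\Omega .$$ A weak solution is a function $B\in L^2(0,T;V)$ that has a weak time derivative $B'\in L^2(0,T;V')$,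 satisfies for every $v\in V$ $$\langle B'(t),v\rangle+(\beta\,\nabla\times B(t),\nabla\times v)=\langle F(t),v\rangle\qquad\text{for a.e. }t\in(0,T),$$ and agrees a.e. on $(0,T)$ with a function in $C([0,T];L^2(\Omega)^3)$ whose value at $t=0$ is $B_0$. Theorem (linear well-posedness). Let $B_0\in L^2(\Omega)^3$, and let $F\in L^2(0,T;L^2(\Omega)^3)$ or, more generally, $F\in L^2(0,T;V')$. Then there is exactly one weak solution $B$. If moreover $\nabla\cdot B_0=0$ and $\nabla\cdot F(t)=0$ for a.e. $t\in(0,T)$, then $\nabla\cdot B(t)=0$ for a.e. $t\in(0,T)$. Here the divergence is taken in the sense of distributions, and for $F(t)\in V'$ the condition $\nabla\cdot F(t)=0$ means that $\langle F(t),\nabla\varphi\rangle=0$ for all $\varphi\in C_c^\infty(\Omega)$. -/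

import Mathlib

open MeasureTheory TopologicalSpace Set
open scoped Distributions

/-- Three-dimensional Euclidean space. -/
abbrev E3 : Type := EuclideanSpace ℝ (Fin 3)

/-- The `i`-th standard basis vector of `ℝ³`. -/
noncomputable def basisVec (i : Fin 3) : E3 := EuclideanSpace.single i (1 : ℝ)

/-- The space `L²(Ω)³` of square integrable vector fields on `Ω`. -/
abbrev L2Field (Ω : Opens E3) : Type := Lp E3 2 (volume.restrict (Ω : Set E3))

/-- The curl as a function of the first order partial derivatives: if `J i` is the vector
`∂ᵢ u` (so that `J i j = ∂ᵢ uⱼ`), then `curlOf J` is the vector `∇ × u`. -/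
noncomputable def curlOf (J : Fin 3 → E3) : E3 :=
  !₂[J 1 2 - J 2 1, J 2 0 - J 0 2, J 0 1 - J 1 0]

/-- The classical curl of a differentiable vector field. -/
noncomputable def classicalCurl (u : E3 → E3) (x : E3) : E3 :=
  curlOf fun i => fderiv ℝ u x (basisVec i)

/-- `C = ∇ × A` on `Ω` in the sense of distributions. -/
def IsWeakCurl (Ω : Opens E3) (A C : L2Field Ω) : Prop :=
  ∀ φ : 𝓓(Ω, E3),
    ∫ x in (Ω : Set E3), inner ℝ (C x) (φ x) =
      ∫ x in (Ω : Set E3), inner ℝ (A x) (classicalCurl φ x)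

/-- `G i = ∂ᵢ u` on `Ω` in the sense of distributions, for `i = 0, 1, 2`. Hence `u ∈ L²(Ω)³` belongs
to `H¹(Ω)³` if and only if there is `G` with `IsWeakGradient Ω u G`. -/
def IsWeakGradient (Ω : Opens E3) (u : L2Field Ω) (G : Fin 3 → L2Field Ω) : Prop :=
  ∀ (i : Fin 3) (ψ : 𝓓(Ω, ℝ)),
    ∫ x in (Ω : Set E3), (fderiv ℝ ψ x (basisVec i)) • u x =
      -∫ x in (Ω : Set E3), ψ x • G i x

/-- The boundary condition `n × A = 0` on `∂Ω` for a field `A ∈ L²(Ω)³` with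
`C = ∇ × A ∈ L²(Ω)³`: the tangential trace functional
`φ ↦ (∇ × A, φ) - (A, ∇ × φ)` vanishes for all `φ ∈ H¹(Ω)³`. -/
def HasZeroTangentialTrace (Ω : Opens E3) (A C : L2Field Ω) : Prop :=
  ∀ (φ : L2Field Ω) (G : Fin 3 → L2Field Ω), IsWeakGradient Ω φ G →
    ∫ x in (Ω : Set E3), inner ℝ (C x) (φ x) =
      ∫ x in (Ω : Set E3), inner ℝ (A x) (curlOf fun i => G i x)

section Helpers

theorem continuous_classicalCurl {Ω : Opens E3} (φ : 𝓓(Ω, E3)) :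
    Continuous (classicalCurl φ) := by
  have h : ∀ i j : Fin 3, Continuous fun x => (fderiv ℝ φ x (basisVec i)) j := by
    intro i j
    have h1 : Continuous (fderiv ℝ φ) := φ.contDiff.continuous_fderiv (by simp)
    have h2 : Continuous fun x => fderiv ℝ φ x (basisVec i) := h1.clm_apply continuous_const
    exact (EuclideanSpace.proj (𝕜 := ℝ) j).continuous.comp h2
  refine (PiLp.continuous_toLp 2 _).comp (continuous_pi fun k => ?_)
  fin_cases k
  · exact (h 1 2).sub (h 2 1)
  · exact (h 2 0).sub (h 0 2)
  · exact (h 0 1).sub (h 1 0)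

theorem hasCompactSupport_classicalCurl {Ω : Opens E3} (φ : 𝓓(Ω, E3)) :
    HasCompactSupport (classicalCurl φ) := by
  refine (φ.hasCompactSupport.fderiv ℝ).mono' fun x hx => subset_tsupport _ ?_
  intro h0
  apply hx
  ext k
  fin_cases k <;> simp [classicalCurl, curlOf, h0]

theorem memLp_curlOf {Ω : Opens E3} (G : Fin 3 → L2Field Ω) :
    MemLp (fun x => curlOf fun i => G i x) 2 (volume.restrict (Ω : Set E3)) := by
  have h : ∀ i j : Fin 3, MemLp (fun x => (G i x) j) 2 (volume.restrict (Ω : Set E3)) :=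
    fun i j => (EuclideanSpace.proj (𝕜 := ℝ) j).comp_memLp' (Lp.memLp (G i))
  refine MemLp.of_eval_piLp fun k => ?_
  fin_cases k
  · exact (h 1 2).sub (h 2 1)
  · exact (h 2 0).sub (h 0 2)
  · exact (h 0 1).sub (h 1 0)

theorem integrable_inner_field {Ω : Opens E3} (f : L2Field Ω) {w : E3 → E3}
    (hw : MemLp w 2 (volume.restrict (Ω : Set E3))) :
    Integrable (fun x => inner ℝ (f x) (w x)) (volume.restrict (Ω : Set E3)) := by
  refine (L2.integrable_inner (𝕜 := ℝ) f hw.toLp).congr ?_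
  filter_upwards [hw.coeFn_toLp] with x hx
  rw [hx]

/-- The pairing of `Lp` classes with a fixed square integrable field is additive. -/
theorem integral_inner_add {Ω : Opens E3} (f g : L2Field Ω) {w : E3 → E3}
    (hw : MemLp w 2 (volume.restrict (Ω : Set E3))) :
    ∫ x in (Ω : Set E3), inner ℝ ((f + g : L2Field Ω) x) (w x) =
      (∫ x in (Ω : Set E3), inner ℝ (f x) (w x)) + ∫ x in (Ω : Set E3), inner ℝ (g x) (w x) := by
  rw [← integral_add (integrable_inner_field f hw) (integrable_inner_field g hw)]
  refine integral_congr_ae ?_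
  filter_upwards [Lp.coeFn_add f g] with x hx
  rw [hx, Pi.add_apply, inner_add_left]

theorem integral_inner_smul {Ω : Opens E3} (c : ℝ) (f : L2Field Ω) (w : E3 → E3) :
    ∫ x in (Ω : Set E3), inner ℝ ((c • f : L2Field Ω) x) (w x) =
      c * ∫ x in (Ω : Set E3), inner ℝ (f x) (w x) := by
  rw [← integral_const_mul]
  refine integral_congr_ae ?_
  filter_upwards [Lp.coeFn_smul c f] with x hx
  rw [hx, Pi.smul_apply, real_inner_smul_left]

theorem integral_inner_zero {Ω : Opens E3} (w : E3 → E3) :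
    ∫ x in (Ω : Set E3), inner ℝ ((0 : L2Field Ω) x) (w x) = 0 := by
  simpa using integral_inner_smul (Ω := Ω) 0 0 w

end Helpers

/-- The space `H₀(curl; Ω)` of all `A ∈ L²(Ω)³` with `∇ × A ∈ L²(Ω)³` and `n × A = 0` on `∂Ω`.
A field `A` is represented by the pair `(A, ∇ × A)` (the second entry is determined by the first).
The `ℓ²` product norm on pairs is the graph norm
`‖A‖²_{H(curl)} = ‖A‖²_{L²} + ‖∇ × A‖²_{L²}`. -/
def HCurlZero (Ω : Opens E3) : Submodule ℝ (WithLp 2 (L2Field Ω × L2Field Ω)) where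
  carrier := {p | IsWeakCurl Ω p.fst p.snd ∧ HasZeroTangentialTrace Ω p.fst p.snd}
  zero_mem' := by
    refine ⟨fun φ => ?_, fun φ G _ => ?_⟩ <;>
      simp only [WithLp.zero_fst, WithLp.zero_snd, integral_inner_zero]
  add_mem' := by
    rintro p q ⟨hp1, hp2⟩ ⟨hq1, hq2⟩
    refine ⟨fun φ => ?_, fun φ G h => ?_⟩
    · rw [WithLp.add_fst, WithLp.add_snd,
        integral_inner_add _ _ (φ.continuous.memLp_of_hasCompactSupport φ.hasCompactSupport),
        integral_inner_add _ _ ((continuous_classicalCurl φ).memLp_of_hasCompactSupport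
          (hasCompactSupport_classicalCurl φ)), hp1 φ, hq1 φ]
    · rw [WithLp.add_fst, WithLp.add_snd, integral_inner_add _ _ (Lp.memLp φ),
        integral_inner_add _ _ (memLp_curlOf G), hp2 φ G h, hq2 φ G h]
  smul_mem' := by
    rintro c p ⟨hp1, hp2⟩
    refine ⟨fun φ => ?_, fun φ G h => ?_⟩
    · rw [WithLp.smul_fst, WithLp.smul_snd, integral_inner_smul, integral_inner_smul, hp1 φ]
    · rw [WithLp.smul_fst, WithLp.smul_snd, integral_inner_smul, integral_inner_smul, hp2 φ G h]

/-- The embedding `H₀(curl; Ω) → L²(Ω)³`. -/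
noncomputable def toField {Ω : Opens E3} : HCurlZero Ω →L[ℝ] L2Field Ω :=
  (WithLp.fstL 2 ℝ (L2Field Ω) (L2Field Ω)).comp (HCurlZero Ω).subtypeL

/-- The curl `∇ × : H₀(curl; Ω) → L²(Ω)³`. -/
noncomputable def curl {Ω : Opens E3} : HCurlZero Ω →L[ℝ] L2Field Ω :=
  (WithLp.sndL 2 ℝ (L2Field Ω) (L2Field Ω)).comp (HCurlZero Ω).subtypeL

/-- The dual space `H₀(curl; Ω)'`. -/
abbrev HCurlZeroDual (Ω : Opens E3) : Type := StrongDual ℝ (HCurlZero Ω)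

/-- The embedding `L²(Ω)³ → H₀(curl; Ω)'`, `g ↦ (v ↦ (g, v)_{L²})`. -/
noncomputable def fieldToDual {Ω : Opens E3} (g : L2Field Ω) : HCurlZeroDual Ω :=
  (innerSL ℝ g).comp toField

/-- The Bochner space `L²(0, T; X)`. -/
abbrev BochnerL2 (T : ℝ) (X : Type) [NormedAddCommGroup X] : Type :=
  Lp X 2 (volume.restrict (Ioo (0 : ℝ) T))

/-- `B'` is the weak time derivative of `B` on `(0, T)`, as a distribution on `(0, T)` with values
in `H₀(curl; Ω)'`, where `H₀(curl; Ω) ⊆ L²(Ω)³ ⊆ H₀(curl; Ω)'`. -/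
def IsWeakTimeDeriv {Ω : Opens E3} {T : ℝ} (B : BochnerL2 T (HCurlZero Ω))
    (B' : BochnerL2 T (HCurlZeroDual Ω)) : Prop :=
  ∀ ψ : 𝓓((⟨Ioo 0 T, isOpen_Ioo⟩ : Opens ℝ), ℝ),
    ∫ t in Ioo 0 T, deriv ψ t • fieldToDual (toField (B t)) = -∫ t in Ioo 0 T, ψ t • B' t

/-- `B ∈ L²(0, T; H₀(curl; Ω))` is a weak solution of `∂ₜB + ∇ × (β ∇ × B) = F`, `n × B = 0` on
`∂Ω`, `B(0) = B₀`: there is a weak time derivative `B' ∈ L²(0, T; H₀(curl; Ω)')`, for every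
`v ∈ H₀(curl; Ω)` the identity `⟨B'(t), v⟩ + (β ∇ × B(t), ∇ × v) = ⟨F(t), v⟩` holds for almost
every `t ∈ (0, T)`, and `B` agrees almost everywhere on `(0, T)` with a function in
`C([0, T]; L²(Ω)³)` whose value at `0` is `B₀`. -/
def IsWeakSolution (Ω : Opens E3) (β : E3 → ℝ) (T : ℝ) (F : ℝ → HCurlZeroDual Ω)
    (B₀ : L2Field Ω) (B : BochnerL2 T (HCurlZero Ω)) : Prop :=
  (∃ B' : BochnerL2 T (HCurlZeroDual Ω), IsWeakTimeDeriv B B' ∧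
    ∀ v : HCurlZero Ω, ∀ᵐ t ∂(volume.restrict (Ioo 0 T)),
      B' t v + ∫ x in (Ω : Set E3), β x * inner ℝ (curl (B t) x) (curl v x) = F t v) ∧
  ∃ b : ℝ → L2Field Ω, ContinuousOn b (Icc 0 T) ∧ b 0 = B₀ ∧
    ∀ᵐ t ∂(volume.restrict (Ioo 0 T)), b t = toField (B t)

/-- `∇ · A = 0` on `Ω` in the sense of distributions. -/
def IsDivFree {Ω : Opens E3} (A : L2Field Ω) : Prop :=
  ∀ φ : 𝓓(Ω, ℝ), ∫ x in (Ω : Set E3), inner ℝ (A x) (gradient φ x) = 0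

/-- A functional `ℓ ∈ H₀(curl; Ω)'` is divergence free if `⟨ℓ, ∇φ⟩ = 0` for all `φ ∈ C_c^∞(Ω)`.
For `ℓ = fieldToDual g` this says that `∇ · g = 0` in the sense of distributions. -/
def IsDivFreeDual {Ω : Opens E3} (ℓ : HCurlZeroDual Ω) : Prop :=
  ∀ (φ : 𝓓(Ω, ℝ)) (v : HCurlZero Ω),
    (∀ᵐ x ∂(volume.restrict (Ω : Set E3)), toField v x = gradient φ x) → ℓ v = 0

/-!
The problem is an instance of an abstract one. Let `i : V → H` be an injective operator with dense
range between Hilbert spaces (here `H₀(curl; Ω) → L²(Ω)³`) and let `A : V → V` be the Riesz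
representative of a *symmetric* nonnegative form (here `(β ∇ × u, ∇ × v)`) with
`c ‖v‖² ≤ ⟨A v, v⟩ + ‖i v‖²`. After identifying `V'` with `V`, the equation reads
`(i† i B)' + A B = f`, `i B(0) = B₀`.

By the du Bois-Reymond lemma a weak solution is the same as a solution of the equation integrated
over time, `i† b(t) + ∫₀ᵗ A B = i† B₀ + ∫₀ᵗ f`, where `b` is the continuous representative of `i B`
(`IsEvolutionSolution.exists_isIntegratedSolution`, `IsIntegratedSolution.isEvolutionSolution`).
The symmetry of `A` gives `∫ ⟨A B, ∫₀ᵗ B⟩ = ½ ⟨A ∫ B, ∫ B⟩ ≥ 0` by reflection of the square in its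
diagonal (`integral_inner_primitive_of_symmetric`), so that testing the integrated equation with
`B` itself controls `∫ ‖i B‖²` (`integral_norm_sq_le`). Everything follows from this:

* Uniqueness: for zero data, `i B = 0`.
* Stability: for `B = b₀ + ∫ w` with `w ∈ L²(V)`, the energy inequality, whose only unfavourable
  term is `∫ ‖i B‖²`, bounds `B` in `L²(V)` and `i B` uniformly by the data `(f, i b₀)` in
  `L²(V) × H` (`exists_energy_bound`).
* Existence: the data of such `B` are dense. If `(g, h)` is orthogonal to all of them, the choice
  `B = ∫ g` gives `i g = 0`, hence `g = 0`, and then `h ⟂ i V` gives `h = 0`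
  (`denseRange_pathData`). So the solution operator extends to all data by continuity, with `i B`
  in the space of bounded continuous functions (`exists_integrated_solution`).

For the concrete spaces, Green's formula shows that test fields lie in `H₀(curl; Ω)`, which gives
the injectivity and the density of the embedding in `L²(Ω)³`. In particular `∇φ` lies there with
vanishing curl, and testing the integrated equation with it yields
`(b(t), ∇φ) = (B₀, ∇φ) + ∫₀ᵗ ⟨F, ∇φ⟩`, so the divergence constraint is conserved.
-/

open scoped BoundedContinuousFunction InnerProductSpace InnerProduct

/-! ### Primitives of vector-valued functions -/

section Primitive

variable {V : Type*} [NormedAddCommGroup V]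

/-- The primitive `t ↦ ∫_{(-∞, t]} w dμ` of `w`. With `μ` Lebesgue measure on `(0, T)` this is
`t ↦ ∫₀ᵗ w` for `t ∈ [0, T]`, extended by constants. -/
noncomputable def primitive [NormedSpace ℝ V] (μ : Measure ℝ) (w : ℝ → V) (t : ℝ) : V :=
  ∫ s in Iic t, w s ∂μ

theorem norm_primitive_le [NormedSpace ℝ V] {μ : Measure ℝ} {w : ℝ → V} (hw : Integrable w μ)
    (t : ℝ) : ‖primitive μ w t‖ ≤ ∫ s, ‖w s‖ ∂μ :=
  (norm_integral_le_integral_norm _).trans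
    (setIntegral_le_integral hw.norm (Filter.Eventually.of_forall fun _ => norm_nonneg _))

theorem continuous_primitive_of_integrable [NormedSpace ℝ V] {μ : Measure ℝ} [NullSingletonClass μ]
    {w : ℝ → V} (hw : Integrable w μ) : Continuous (primitive μ w) := by
  have h : primitive μ w = fun t => primitive μ w 0 + ∫ s in (0 : ℝ)..t, w s ∂μ := by
    funext t
    rw [← intervalIntegral.integral_Iic_sub_Iic hw.integrableOn hw.integrableOn]
    simp [primitive]
  rw [h]
  exact continuous_const.add
    (intervalIntegral.continuous_primitive (fun _ _ => hw.intervalIntegrable) 0)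

theorem integrable_primitive [NormedSpace ℝ V] {μ : Measure ℝ} [IsFiniteMeasure μ]
    [NullSingletonClass μ] {w : ℝ → V} (hw : Integrable w μ) : Integrable (primitive μ w) μ :=
  (integrable_const (∫ s, ‖w s‖ ∂μ)).mono'
    (continuous_primitive_of_integrable hw).aestronglyMeasurable
    (Filter.Eventually.of_forall (norm_primitive_le hw))

theorem ContinuousLinearMap.primitive_comp [NormedSpace ℝ V] [CompleteSpace V] {W : Type*}
    [NormedAddCommGroup W] [NormedSpace ℝ W] [CompleteSpace W] (S : V →L[ℝ] W) {μ : Measure ℝ}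
    {w : ℝ → V} (hw : Integrable w μ) (t : ℝ) :
    primitive μ (fun s => S (w s)) t = S (primitive μ w t) :=
  S.integral_comp_comm hw.integrableOn

theorem primitive_add [NormedSpace ℝ V] {μ : Measure ℝ} {v w : ℝ → V} (hv : Integrable v μ)
    (hw : Integrable w μ) (t : ℝ) :
    primitive μ (fun s => v s + w s) t = primitive μ v t + primitive μ w t :=
  integral_add hv.integrableOn hw.integrableOn

theorem primitive_sub [NormedSpace ℝ V] {μ : Measure ℝ} {v w : ℝ → V} (hv : Integrable v μ)
    (hw : Integrable w μ) (t : ℝ) :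
    primitive μ (fun s => v s - w s) t = primitive μ v t - primitive μ w t :=
  integral_sub hv.integrableOn hw.integrableOn

theorem primitive_congr [NormedSpace ℝ V] {μ : Measure ℝ} {v w : ℝ → V} (h : v =ᵐ[μ] w) (t : ℝ) :
    primitive μ v t = primitive μ w t :=
  integral_congr_ae (ae_restrict_of_ae h)

variable [InnerProductSpace ℝ V]

theorem integrable_inner_primitive {μ : Measure ℝ} [IsFiniteMeasure μ] [NullSingletonClass μ]
    {v w : ℝ → V} (hv : Integrable v μ) (hw : Integrable w μ) :
    Integrable (fun t => ⟪v t, primitive μ w t⟫_ℝ) μ := by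
  refine (hv.norm.mul_const (∫ s, ‖w s‖ ∂μ)).mono'
    (hv.aestronglyMeasurable.inner
      (continuous_primitive_of_integrable hw).aestronglyMeasurable)
    (Filter.Eventually.of_forall fun t => ?_)
  exact (norm_inner_le_norm _ _).trans
    (mul_le_mul_of_nonneg_left (norm_primitive_le hw t) (norm_nonneg _))

variable [CompleteSpace V]

/-- For a symmetric operator `S`, the integral of `⟨S w, W⟩` with `W` the primitive of `w` is half
of the integral of `⟨S w(t), w(s)⟩` over the square, by reflection in the diagonal. This replaces
the product rule `d/dt ⟨S W, W⟩ = 2 ⟨S W', W⟩`. -/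
theorem integral_inner_primitive_of_symmetric {μ : Measure ℝ} [IsFiniteMeasure μ]
    [NullSingletonClass μ] {S : V →L[ℝ] V} (hS : ∀ u v, ⟪S u, v⟫_ℝ = ⟪S v, u⟫_ℝ) {w : ℝ → V}
    (hw : Integrable w μ) :
    2 * ∫ t, ⟪S (w t), primitive μ w t⟫_ℝ ∂μ = ⟪S (∫ t, w t ∂μ), ∫ t, w t ∂μ⟫_ℝ := by
  have hk : Integrable (fun z : ℝ × ℝ => ⟪S (w z.1), w z.2⟫_ℝ) (μ.prod μ) :=
    Integrable.op_fst_snd (op := fun x y : V => ⟪x, y⟫_ℝ) continuous_inner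
      ⟨1, fun x y => by simpa using norm_inner_le_norm (𝕜 := ℝ) x y⟩ (S.integrable_comp hw) hw
  have hslice : ∀ t, Integrable (fun s => ⟪S (w t), w s⟫_ℝ) μ := fun t => hw.const_inner _
  have hpr : ∀ t, ⟪S (w t), primitive μ w t⟫_ℝ = ∫ s in Iic t, ⟪S (w t), w s⟫_ℝ ∂μ := fun t =>
    ((innerSL ℝ (S (w t))).integral_comp_comm hw.integrableOn).symm
  have hD : MeasurableSet {z : ℝ × ℝ | z.2 ≤ z.1} := measurableSet_le measurable_snd measurable_fst
  have hswap : ∫ t, ∫ s in Iic t, ⟪S (w t), w s⟫_ℝ ∂μ ∂μ =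
      ∫ t, ∫ s in Ici t, ⟪S (w t), w s⟫_ℝ ∂μ ∂μ := by
    have e1 : ∀ t, ∫ s in Iic t, ⟪S (w t), w s⟫_ℝ ∂μ =
        ∫ s, {z : ℝ × ℝ | z.2 ≤ z.1}.indicator (fun z => ⟪S (w z.1), w z.2⟫_ℝ) (t, s) ∂μ := by
      intro t
      rw [← integral_indicator measurableSet_Iic]
      rfl
    have e2 : ∀ t, ∫ s in Ici t, ⟪S (w t), w s⟫_ℝ ∂μ =
        ∫ s, {z : ℝ × ℝ | z.2 ≤ z.1}.indicator (fun z => ⟪S (w z.1), w z.2⟫_ℝ) (s, t) ∂μ := by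
      intro t
      rw [← integral_indicator measurableSet_Ici]
      refine integral_congr_ae (Filter.Eventually.of_forall fun s => ?_)
      by_cases h : t ≤ s
      · simp [indicator, h, hS (w t)]
      · simp [indicator, h]
    simp_rw [e1, e2]
    exact integral_integral_swap (f := fun t s =>
      {z : ℝ × ℝ | z.2 ≤ z.1}.indicator (fun z => ⟪S (w z.1), w z.2⟫_ℝ) (t, s))
      (hk.indicator hD)
  have hsum : ∀ t, (∫ s in Iic t, ⟪S (w t), w s⟫_ℝ ∂μ) + ∫ s in Ici t, ⟪S (w t), w s⟫_ℝ ∂μ =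
      ⟪S (w t), ∫ s, w s ∂μ⟫_ℝ := by
    intro t
    rw [integral_Ici_eq_integral_Ioi, ← compl_Iic,
      integral_add_compl measurableSet_Iic (hslice t)]
    exact (innerSL ℝ (S (w t))).integral_comp_comm hw
  have hI : Integrable (fun t => ∫ s in Iic t, ⟪S (w t), w s⟫_ℝ ∂μ) μ := by
    simpa only [hpr] using integrable_inner_primitive (S.integrable_comp hw) hw
  have hI' : Integrable (fun t => ∫ s in Ici t, ⟪S (w t), w s⟫_ℝ ∂μ) μ := by
    have : (fun t => ∫ s in Ici t, ⟪S (w t), w s⟫_ℝ ∂μ) = fun t =>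
        ⟪S (w t), ∫ s, w s ∂μ⟫_ℝ - ∫ s in Iic t, ⟪S (w t), w s⟫_ℝ ∂μ := by
      funext t; rw [← hsum t]; ring
    rw [this]
    exact ((S.integrable_comp hw).inner_const _).sub hI
  simp_rw [hpr]
  rw [two_mul]
  nth_rewrite 2 [hswap]
  rw [← integral_add hI hI']
  simp_rw [hsum]
  rw [← S.integral_comp_comm hw, real_inner_comm]
  refine Eq.trans (integral_congr_ae (Filter.Eventually.of_forall fun t => ?_))
    ((innerSL ℝ (∫ s, w s ∂μ)).integral_comp_comm (S.integrable_comp hw))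
  exact real_inner_comm _ _

theorem integral_inner_primitive_nonneg {μ : Measure ℝ} [IsFiniteMeasure μ] [NullSingletonClass μ]
    {S : V →L[ℝ] V} (hS : ∀ u v, ⟪S u, v⟫_ℝ = ⟪S v, u⟫_ℝ) (hS0 : ∀ u, 0 ≤ ⟪S u, u⟫_ℝ)
    {w : ℝ → V} (hw : Integrable w μ) : 0 ≤ ∫ t, ⟪S (w t), primitive μ w t⟫_ℝ ∂μ := by
  have := integral_inner_primitive_of_symmetric hS hw
  have := hS0 (∫ t, w t ∂μ)
  linarith

/-- The fundamental theorem of calculus for `⟨S B, B⟩` with `B = b + ∫ w`. -/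
theorem inner_add_integral_self {μ : Measure ℝ} [IsFiniteMeasure μ] [NullSingletonClass μ]
    {S : V →L[ℝ] V} (hS : ∀ u v, ⟪S u, v⟫_ℝ = ⟪S v, u⟫_ℝ) {w : ℝ → V} (hw : Integrable w μ)
    (b : V) : ⟪S (b + ∫ t, w t ∂μ), b + ∫ t, w t ∂μ⟫_ℝ =
      ⟪S b, b⟫_ℝ + 2 * ∫ t, ⟪S (w t), b + primitive μ w t⟫_ℝ ∂μ := by
  have h1 : ∫ t, ⟪S (w t), b + primitive μ w t⟫_ℝ ∂μ =
      ⟪S (∫ t, w t ∂μ), b⟫_ℝ + ∫ t, ⟪S (w t), primitive μ w t⟫_ℝ ∂μ := by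
    simp_rw [inner_add_right]
    rw [integral_add ((S.integrable_comp hw).inner_const _)
      (integrable_inner_primitive (S.integrable_comp hw) hw), ← S.integral_comp_comm hw]
    congr 1
    simp_rw [real_inner_comm b]
    exact (innerSL ℝ b).integral_comp_comm (S.integrable_comp hw)
  have h2 := integral_inner_primitive_of_symmetric hS hw
  have h3 := hS b (∫ t, w t ∂μ)
  rw [h1, map_add, inner_add_left, inner_add_right, inner_add_right]
  linarith

end Primitive

/-! ### Energy estimates -/

section Estimates

theorem integral_norm_mul_norm_le {α E F : Type*} [MeasurableSpace α] {μ : Measure α}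
    [NormedAddCommGroup E] [NormedAddCommGroup F] {f : α → E} {g : α → F} (hf : MemLp f 2 μ)
    (hg : MemLp g 2 μ) :
    ∫ x, ‖f x‖ * ‖g x‖ ∂μ ≤ (eLpNorm f 2 μ).toReal * (eLpNorm g 2 μ).toReal := by
  have h := real_inner_le_norm hg.norm.toLp hf.norm.toLp
  rw [L2.inner_def, Lp.norm_toLp, Lp.norm_toLp, eLpNorm_norm, eLpNorm_norm] at h
  refine (le_of_eq (integral_congr_ae ?_)).trans (h.trans (mul_comm _ _).le)
  filter_upwards [hf.norm.coeFn_toLp, hg.norm.coeFn_toLp] with x hx hy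
  simp [hx, hy]

theorem MeasureTheory.MemLp.integral_norm_sq {α E : Type*} [MeasurableSpace α] {μ : Measure α}
    [NormedAddCommGroup E] {f : α → E} (hf : MemLp f 2 μ) :
    ∫ x, ‖f x‖ ^ 2 ∂μ = (eLpNorm f 2 μ).toReal ^ 2 := by
  have h := real_inner_self_eq_norm_sq hf.norm.toLp
  rw [L2.inner_def, Lp.norm_toLp, eLpNorm_norm] at h
  rw [← h]
  refine integral_congr_ae ?_
  filter_upwards [hf.norm.coeFn_toLp] with x hx
  simp [hx]

theorem MeasureTheory.MemLp.integrable_inner {α E : Type*} [MeasurableSpace α] {μ : Measure α}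
    [NormedAddCommGroup E] [InnerProductSpace ℝ E] {f g : α → E} (hf : MemLp f 2 μ)
    (hg : MemLp g 2 μ) : Integrable (fun x => ⟪f x, g x⟫_ℝ) μ := by
  refine (L2.integrable_inner (𝕜 := ℝ) hf.toLp hg.toLp).congr ?_
  filter_upwards [hf.coeFn_toLp, hg.coeFn_toLp] with x hx hy
  rw [hx, hy]

variable {V H : Type*} [NormedAddCommGroup V] [InnerProductSpace ℝ V] [CompleteSpace V]
  [NormedAddCommGroup H] [InnerProductSpace ℝ H] [CompleteSpace H]
  {i : V →L[ℝ] H} {A : V →L[ℝ] V} {c : ℝ}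

/-- The energy inequality for `(i† i B)' + A B = f` with `B = b₀ + ∫ w`, up to the end of time. -/
theorem energy_inequality (hc : ∀ u, c * ‖u‖ ^ 2 ≤ ⟪A u, u⟫_ℝ + ‖i u‖ ^ 2)
    {μ : Measure ℝ} [IsFiniteMeasure μ] [NullSingletonClass μ] {w f B : ℝ → V} (b₀ : V)
    (hw : MemLp w 2 μ) (hf : MemLp f 2 μ) (hB : MemLp B 2 μ)
    (hBw : ∀ᵐ t ∂μ, B t = b₀ + primitive μ w t)
    (hfw : ∀ᵐ t ∂μ, f t = i.adjoint (i (w t)) + A (B t)) :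
    ‖i (b₀ + ∫ t, w t ∂μ)‖ ^ 2 + 2 * c * ∫ t, ‖B t‖ ^ 2 ∂μ ≤
      ‖i b₀‖ ^ 2 + 2 * ∫ t, ⟪f t, B t⟫_ℝ ∂μ + 2 * ∫ t, ‖i (B t)‖ ^ 2 ∂μ := by
  have hw1 : Integrable w μ := hw.integrable one_le_two
  have h := inner_add_integral_self (μ := μ) (S := i.adjoint ∘L i) (w := w)
    (fun u v => by
      simp only [ContinuousLinearMap.comp_apply, ContinuousLinearMap.adjoint_inner_left]
      exact real_inner_comm _ _) hw1 b₀
  simp only [ContinuousLinearMap.comp_apply, ContinuousLinearMap.adjoint_inner_left,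
    real_inner_self_eq_norm_sq] at h
  have hi1 : Integrable (fun t => c * ‖B t‖ ^ 2) μ := (hB.integrable_norm_pow (by simp)).const_mul c
  have hi2 : Integrable (fun t => ‖i (B t)‖ ^ 2) μ :=
    (i.comp_memLp' hB).integrable_norm_pow (by simp)
  have hi3 := hf.integrable_inner hB
  have hi5 : Integrable (fun t => ⟪f t, B t⟫_ℝ - c * ‖B t‖ ^ 2) μ := hi3.sub hi1
  have hi4 : Integrable (fun t => ⟪i (w t), i (B t)⟫_ℝ) μ :=
    (i.comp_memLp' hw).integrable_inner (i.comp_memLp' hB)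
  have hmono : ∫ t, ⟪i (w t), i (b₀ + primitive μ w t)⟫_ℝ ∂μ ≤
      ∫ t, (⟪f t, B t⟫_ℝ - c * ‖B t‖ ^ 2 + ‖i (B t)‖ ^ 2) ∂μ := by
    have e : ∫ t, ⟪i (w t), i (b₀ + primitive μ w t)⟫_ℝ ∂μ = ∫ t, ⟪i (w t), i (B t)⟫_ℝ ∂μ := by
      refine integral_congr_ae ?_
      filter_upwards [hBw] with t ht
      rw [ht]
    rw [e]
    refine integral_mono_ae hi4 (hi5.add hi2) ?_
    filter_upwards [hfw] with t ht
    have h1 := hc (B t)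
    have h2 : ⟪f t, B t⟫_ℝ = ⟪i (w t), i (B t)⟫_ℝ + ⟪A (B t), B t⟫_ℝ := by
      rw [ht, inner_add_left, ContinuousLinearMap.adjoint_inner_left]
    linarith
  rw [integral_add hi5 hi2, integral_sub hi3 hi1, integral_const_mul] at hmono
  rw [h]
  linarith

/-- The weak estimate for `(i† i B)' + A B = f`, obtained by testing the equation integrated in
time with `B`: there the form contributes `½ ⟨A ∫ B, ∫ B⟩ ≥ 0`. -/
theorem integral_norm_sq_le (hA : ∀ u v, ⟪A u, v⟫_ℝ = ⟪A v, u⟫_ℝ) (hA0 : ∀ u, 0 ≤ ⟪A u, u⟫_ℝ)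
    {μ : Measure ℝ} [IsFiniteMeasure μ] [NullSingletonClass μ] {f B : ℝ → V} {b : ℝ → H} (b₀ : H)
    (hf : MemLp f 2 μ) (hB : MemLp B 2 μ) (hb : ∀ᵐ t ∂μ, b t = i (B t))
    (h : ∀ᵐ t ∂μ, i.adjoint (b t) + primitive μ (fun s => A (B s)) t =
      i.adjoint b₀ + primitive μ f t) :
    ∫ t, ‖i (B t)‖ ^ 2 ∂μ ≤ μ.real univ * ‖b₀‖ ^ 2 +
      2 * ((∫ t, ‖f t‖ ∂μ) * ∫ t, ‖B t‖ ∂μ) := by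
  have hB1 : Integrable B μ := hB.integrable one_le_two
  have hf1 : Integrable f μ := hf.integrable one_le_two
  have hi2 : Integrable (fun t => ‖i (B t)‖ ^ 2) μ :=
    (i.comp_memLp' hB).integrable_norm_pow (by simp)
  have hi3 : Integrable (fun t => ⟪A (B t), primitive μ B t⟫_ℝ) μ :=
    integrable_inner_primitive (A.integrable_comp hB1) hB1
  have hpos := integral_inner_primitive_nonneg hA hA0 hB1
  have hmono : ∫ t, (‖i (B t)‖ ^ 2 + 2 * ⟪A (B t), primitive μ B t⟫_ℝ) ∂μ ≤
      ∫ t, (‖b₀‖ ^ 2 + 2 * ((∫ s, ‖f s‖ ∂μ) * ‖B t‖)) ∂μ := by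
    refine integral_mono_ae (hi2.add (hi3.const_mul 2))
      ((integrable_const _).add ((hB1.norm.const_mul _).const_mul 2)) ?_
    filter_upwards [h, hb] with t ht hbt
    have h1 := congrArg (fun z => ⟪z, B t⟫_ℝ) ht
    simp only [inner_add_left, ContinuousLinearMap.adjoint_inner_left] at h1
    rw [hbt, real_inner_self_eq_norm_sq, A.primitive_comp hB1, hA] at h1
    have h2 : ⟪primitive μ f t, B t⟫_ℝ ≤ (∫ s, ‖f s‖ ∂μ) * ‖B t‖ :=
      (real_inner_le_norm _ _).trans
        (mul_le_mul_of_nonneg_right (norm_primitive_le hf1 t) (norm_nonneg _))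
    have h3 := real_inner_le_norm b₀ (i (B t))
    have h4 := two_mul_le_add_sq ‖b₀‖ ‖i (B t)‖
    linarith
  rw [integral_add hi2 (hi3.const_mul 2), integral_const_mul, integral_add (integrable_const _)
    ((hB1.norm.const_mul _).const_mul 2), integral_const_mul, integral_const_mul,
    integral_const, smul_eq_mul] at hmono
  linarith

theorem integral_norm_le {α E : Type*} [MeasurableSpace α] {μ : Measure α} [IsFiniteMeasure μ]
    [NormedAddCommGroup E] {f : α → E} (hf : MemLp f 2 μ) :
    ∫ x, ‖f x‖ ∂μ ≤ (eLpNorm f 2 μ).toReal * (eLpNorm (fun _ : α => (1 : ℝ)) 2 μ).toReal := by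
  simpa using integral_norm_mul_norm_le hf (memLp_const (1 : ℝ))

/-- Stability of `(i† i B)' + A B = f`, `B = b₀ + ∫ w`, in `L²(V)` and `L^∞(H)`. The weak estimate
`integral_norm_sq_le` bounds the lower order term of the energy inequality, so that no Gronwall
argument is needed. -/
theorem exists_energy_bound (hA : ∀ u v, ⟪A u, v⟫_ℝ = ⟪A v, u⟫_ℝ) (hA0 : ∀ u, 0 ≤ ⟪A u, u⟫_ℝ)
    (hc0 : 0 < c) (hc : ∀ u, c * ‖u‖ ^ 2 ≤ ⟪A u, u⟫_ℝ + ‖i u‖ ^ 2)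
    (μ : Measure ℝ) [IsFiniteMeasure μ] [NullSingletonClass μ] :
    ∃ C : ℝ, 0 ≤ C ∧ ∀ (w f B : ℝ → V) (b₀ : V), MemLp w 2 μ → MemLp f 2 μ → MemLp B 2 μ →
      (∀ t, B t = b₀ + primitive μ w t) →
      (∀ᵐ t ∂μ, f t = i.adjoint (i (w t)) + A (B t)) →
      (eLpNorm B 2 μ).toReal ^ 2 ≤ C * ((eLpNorm f 2 μ).toReal ^ 2 + ‖i b₀‖ ^ 2) ∧
      ∀ t, ‖i (B t)‖ ^ 2 ≤ C * ((eLpNorm f 2 μ).toReal ^ 2 + ‖i b₀‖ ^ 2) := by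
  set κ := (eLpNorm (fun _ : ℝ => (1 : ℝ)) 2 μ).toReal with hκ
  set p := 1 + 2 * μ.real univ + 2 * κ ^ 2 with hp
  have hp1 : 1 ≤ p := by
    have := measureReal_nonneg (μ := μ) (s := univ)
    nlinarith [sq_nonneg κ]
  have hM : 0 ≤ μ.real univ := measureReal_nonneg
  -- `N² ≤ C₁ (F² + e²)` for the `L²` norm `N` of `B`
  set C₁ := p / c + p ^ 2 / c ^ 2 with hC₁
  have hC₁0 : 0 ≤ C₁ := by positivity
  refine ⟨C₁ + (p + p * C₁), by positivity, fun w f B b₀ hw hf hB hBw hfw => ?_⟩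
  set F := (eLpNorm f 2 μ).toReal with hF
  set N := (eLpNorm B 2 μ).toReal with hN
  set e := ‖i b₀‖ with he
  have hF0 : 0 ≤ F := ENNReal.toReal_nonneg
  have hN0 : 0 ≤ N := ENNReal.toReal_nonneg
  have hw1 : Integrable w μ := hw.integrable one_le_two
  have hB1 : Integrable B μ := hB.integrable one_le_two
  have hint : ∀ t, i.adjoint (i (B t)) + primitive μ (fun s => A (B s)) t =
      i.adjoint (i b₀) + primitive μ f t := by
    intro t
    have h1 : primitive μ f t = primitive μ (fun s => (i.adjoint ∘L i) (w s) + A (B s)) t :=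
      primitive_congr hfw t
    rw [h1, primitive_add (ContinuousLinearMap.integrable_comp _ hw1) (A.integrable_comp hB1),
      (i.adjoint ∘L i).primitive_comp hw1, ← add_assoc, hBw t]
    simp
  have hweak : ∫ t, ‖i (B t)‖ ^ 2 ∂μ ≤ μ.real univ * e ^ 2 + 2 * κ ^ 2 * (F * N) := by
    refine (integral_norm_sq_le (b := fun t => i (B t)) hA hA0 (i b₀) hf hB
      (Filter.Eventually.of_forall fun _ => rfl) (Filter.Eventually.of_forall hint)).trans ?_
    have := mul_le_mul (integral_norm_le hf) (integral_norm_le hB)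
      (integral_nonneg fun _ => norm_nonneg _) (by positivity)
    rw [← hF, ← hN, ← hκ] at this
    nlinarith
  have hsub : ∀ s : Set ℝ, 2 * ∫ t in s, ⟪f t, B t⟫_ℝ ∂μ + 2 * ∫ t in s, ‖i (B t)‖ ^ 2 ∂μ ≤
      2 * (F * N) + 2 * (μ.real univ * e ^ 2 + 2 * κ ^ 2 * (F * N)) := by
    intro s
    have h1 : ∫ t in s, ⟪f t, B t⟫_ℝ ∂μ ≤ F * N := by
      have hfB : Integrable (fun t => ‖f t‖ * ‖B t‖) μ := hf.norm.integrable_mul hB.norm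
      refine (integral_mono (hf.integrable_inner hB).integrableOn hfB.integrableOn
        fun t => real_inner_le_norm _ _).trans ?_
      exact (setIntegral_le_integral hfB (Filter.Eventually.of_forall fun _ => by
        positivity)).trans (integral_norm_mul_norm_le hf hB)
    have h2 : ∫ t in s, ‖i (B t)‖ ^ 2 ∂μ ≤ ∫ t, ‖i (B t)‖ ^ 2 ∂μ :=
      setIntegral_le_integral ((i.comp_memLp' hB).integrable_norm_pow (by simp))
        (Filter.Eventually.of_forall fun _ => by positivity)
    linarith
  have hglob : N ^ 2 ≤ C₁ * (F ^ 2 + e ^ 2) := by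
    have h1 := energy_inequality hc b₀ hw hf hB (Filter.Eventually.of_forall hBw) hfw
    have h2 := hsub univ
    rw [Measure.restrict_univ] at h2
    rw [hB.integral_norm_sq] at h1
    have h3 : 2 * c * N ^ 2 ≤ p * e ^ 2 + 2 * p * (F * N) := by
      nlinarith [sq_nonneg ‖i (b₀ + ∫ t, w t ∂μ)‖, mul_nonneg hF0 hN0, sq_nonneg κ,
        mul_nonneg (sq_nonneg κ) (sq_nonneg e), mul_nonneg hM (mul_nonneg hF0 hN0)]
    have h4 : 2 * p * (F * N) ≤ c * N ^ 2 + p ^ 2 / c * F ^ 2 := by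
      have : 0 ≤ c * (N - p / c * F) ^ 2 := by positivity
      have h5 : c * (N - p / c * F) ^ 2 = c * N ^ 2 + p ^ 2 / c * F ^ 2 - 2 * p * (F * N) := by
        field_simp
        ring
      linarith
    have h6 : N ^ 2 ≤ p / c * e ^ 2 + p ^ 2 / c ^ 2 * F ^ 2 := by
      have h7 : c * N ^ 2 ≤ c * (p / c * e ^ 2 + p ^ 2 / c ^ 2 * F ^ 2) := by
        have : c * (p / c * e ^ 2 + p ^ 2 / c ^ 2 * F ^ 2) = p * e ^ 2 + p ^ 2 / c * F ^ 2 := by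
          field_simp
        rw [this]
        linarith
      exact le_of_mul_le_mul_left h7 hc0
    have : 0 ≤ p / c * F ^ 2 + p ^ 2 / c ^ 2 * e ^ 2 := by positivity
    rw [hC₁]
    linarith
  refine ⟨hglob.trans ?_, fun t₀ => ?_⟩
  · exact mul_le_mul_of_nonneg_right (by linarith [mul_nonneg (by linarith : 0 ≤ p) hC₁0])
      (by positivity)
  · have hres : ∀ᵐ t ∂(μ.restrict (Iic t₀)), B t = b₀ + primitive (μ.restrict (Iic t₀)) w t := by
      filter_upwards [ae_restrict_mem measurableSet_Iic] with t ht
      rw [hBw t, primitive, primitive, Measure.restrict_restrict measurableSet_Iic,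
        Iic_inter_Iic, min_eq_left ht]
    have h1 := energy_inequality hc b₀ (hw.restrict (Iic t₀)) (hf.restrict _) (hB.restrict _)
      hres (ae_restrict_of_ae hfw)
    have h2 := hsub (Iic t₀)
    have h3 : b₀ + ∫ t in Iic t₀, w t ∂μ = B t₀ := (hBw t₀).symm
    rw [h3] at h1
    have h4 : 0 ≤ 2 * c * ∫ t in Iic t₀, ‖B t‖ ^ 2 ∂μ :=
      mul_nonneg (by positivity) (integral_nonneg fun _ => by positivity)
    have h5 : ‖i (B t₀)‖ ^ 2 ≤ p * e ^ 2 + 2 * p * (F * N) := by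
      nlinarith [mul_nonneg hF0 hN0, mul_nonneg (sq_nonneg κ) (sq_nonneg e),
        mul_nonneg hM (mul_nonneg hF0 hN0)]
    have h6 : 2 * (F * N) ≤ F ^ 2 + N ^ 2 := by nlinarith [sq_nonneg (F - N)]
    have h7 : ‖i (B t₀)‖ ^ 2 ≤ p * e ^ 2 + p * (F ^ 2 + C₁ * (F ^ 2 + e ^ 2)) := by
      nlinarith
    have : 0 ≤ C₁ * (F ^ 2 + e ^ 2) := by positivity
    linarith

end Estimates

/-! ### The abstract evolution equation integrated in time -/

section Evolution

variable {V H : Type*} [NormedAddCommGroup V] [InnerProductSpace ℝ V]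
  [NormedAddCommGroup H] [InnerProductSpace ℝ H]
  {i : V →L[ℝ] H} {A : V →L[ℝ] V} {c : ℝ}
  (μ : Measure ℝ) [IsFiniteMeasure μ] [NullSingletonClass μ]

theorem integrable_coeFn_Lp_two {α E : Type*} [MeasurableSpace α] {μ : Measure α}
    [IsFiniteMeasure μ] [NormedAddCommGroup E] (w : Lp E 2 μ) : Integrable w μ :=
  (Lp.memLp w).integrable one_le_two

/-- The primitive as an operator from `L²(V)` to bounded continuous functions. -/
noncomputable def primitiveL : Lp V 2 μ →L[ℝ] (ℝ →ᵇ V) :=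
  LinearMap.mkContinuous
    { toFun := fun w => BoundedContinuousFunction.ofNormedAddCommGroup (primitive μ w)
        (continuous_primitive_of_integrable (integrable_coeFn_Lp_two w)) (∫ s, ‖w s‖ ∂μ)
        (norm_primitive_le (integrable_coeFn_Lp_two w))
      map_add' := fun v w => by
        ext t
        simp only [BoundedContinuousFunction.coe_ofNormedAddCommGroup,
          BoundedContinuousFunction.coe_add, Pi.add_apply]
        rw [← primitive_add (integrable_coeFn_Lp_two v) (integrable_coeFn_Lp_two w)]
        exact primitive_congr (Lp.coeFn_add v w) t
      map_smul' := fun r w => by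
        ext t
        simp only [BoundedContinuousFunction.coe_ofNormedAddCommGroup,
          BoundedContinuousFunction.coe_smul, RingHom.id_apply]
        rw [primitive_congr (Lp.coeFn_smul r w) t]
        exact integral_smul r _ }
    (eLpNorm (fun _ : ℝ => (1 : ℝ)) 2 μ).toReal fun w => by
      refine (BoundedContinuousFunction.norm_le (by positivity)).2 fun t => ?_
      refine (norm_primitive_le (integrable_coeFn_Lp_two w) t).trans ?_
      rw [mul_comm]
      exact integral_norm_le (Lp.memLp w)

@[simp]
theorem primitiveL_apply (w : Lp V 2 μ) (t : ℝ) : primitiveL μ w t = primitive μ w t := rfl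

/-- The path `t ↦ b₀ + ∫_{(-∞, t]} w dμ` with initial value `b₀` and derivative `w ∈ L²(V)`. -/
noncomputable def pathOf : V × Lp V 2 μ →ₗ[ℝ] (ℝ →ᵇ V) where
  toFun p := BoundedContinuousFunction.const ℝ p.1 + primitiveL μ p.2
  map_add' p q := by
    ext t
    simp only [Prod.fst_add, Prod.snd_add, map_add, BoundedContinuousFunction.coe_add,
      Pi.add_apply, BoundedContinuousFunction.const_apply]
    abel
  map_smul' r p := by
    ext t
    simp

theorem pathOf_apply (p : V × Lp V 2 μ) (t : ℝ) :
    pathOf μ p t = p.1 + primitive μ p.2 t := rfl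

/-- A path is an element of `L²(V)`. -/
noncomputable def pathLp : V × Lp V 2 μ →ₗ[ℝ] Lp V 2 μ :=
  (BoundedContinuousFunction.toLp 2 μ ℝ).toLinearMap ∘ₗ pathOf μ

theorem coeFn_pathLp (p : V × Lp V 2 μ) : pathLp μ p =ᵐ[μ] pathOf μ p :=
  BoundedContinuousFunction.coeFn_toLp 2 μ ℝ (pathOf μ p)

variable [CompleteSpace V] [CompleteSpace H]

/-- The data `((i† i B)' + A B, i B(0))` of the path `B`. -/
noncomputable def pathData (i : V →L[ℝ] H) (A : V →L[ℝ] V) :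
    V × Lp V 2 μ →ₗ[ℝ] WithLp 2 (Lp V 2 μ × H) :=
  (WithLp.linearEquiv 2 ℝ (Lp V 2 μ × H)).symm.toLinearMap ∘ₗ
    LinearMap.prod
      (((i.adjoint ∘L i).compLpL 2 μ).toLinearMap ∘ₗ LinearMap.snd ℝ V (Lp V 2 μ) +
        (A.compLpL 2 μ).toLinearMap ∘ₗ pathLp μ)
      (i.toLinearMap ∘ₗ LinearMap.fst ℝ V (Lp V 2 μ))

theorem pathData_fst (p : V × Lp V 2 μ) :
    (pathData μ i A p).fst = (i.adjoint ∘L i).compLpL 2 μ p.2 + A.compLpL 2 μ (pathLp μ p) := rfl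

theorem pathData_snd (p : V × Lp V 2 μ) : (pathData μ i A p).snd = i p.1 := rfl

/-- The path `B` in `L²(V)` and the path `i B` among bounded continuous functions. -/
noncomputable def pathSolution (i : V →L[ℝ] H) : V × Lp V 2 μ →ₗ[ℝ] Lp V 2 μ × (ℝ →ᵇ H) :=
  LinearMap.prod (pathLp μ) ((i.compLeftContinuousBounded ℝ).toLinearMap ∘ₗ pathOf μ)

theorem coeFn_pathData_fst (p : V × Lp V 2 μ) :
    ∀ᵐ t ∂μ, (pathData μ i A p).fst t = i.adjoint (i (p.2 t)) + A (pathOf μ p t) := by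
  rw [pathData_fst]
  filter_upwards [Lp.coeFn_add ((i.adjoint ∘L i).compLpL 2 μ p.2) (A.compLpL 2 μ (pathLp μ p)),
    (i.adjoint ∘L i).coeFn_compLpL (p := 2) p.2, A.coeFn_compLpL (p := 2) (pathLp μ p),
    coeFn_pathLp μ p] with t h1 h2 h3 h4
  rw [h1, Pi.add_apply, h2, h3, h4]
  rfl

/-- The data of paths are dense: if `(g, h)` is orthogonal to all of them, the path `∫ g` shows
that `g = 0`, and then the constant paths show that `h = 0`. -/
theorem denseRange_pathData (hi : Function.Injective i) (hdense : DenseRange i)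
    (hA : ∀ u v, ⟪A u, v⟫_ℝ = ⟪A v, u⟫_ℝ) (hA0 : ∀ u, 0 ≤ ⟪A u, u⟫_ℝ) :
    DenseRange (pathData μ i A) := by
  have key : (LinearMap.range (pathData μ i A))ᗮ = ⊥ := by
    rw [Submodule.eq_bot_iff]
    intro y hy
    have hy' : ∀ p, ⟪pathData μ i A p, y⟫_ℝ = 0 := fun p =>
      (Submodule.mem_orthogonal _ _).1 hy _ ⟨p, rfl⟩
    have hg : y.fst = 0 := by
      have h := (WithLp.prod_inner_apply _ _).symm.trans (hy' (0, y.fst))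
      change ⟪(pathData μ i A (0, y.fst)).fst, y.fst⟫_ℝ + ⟪i 0, y.snd⟫_ℝ = 0 at h
      rw [map_zero, inner_zero_left, add_zero, L2.inner_def] at h
      have hg1 := integrable_coeFn_Lp_two y.fst
      have hpos := integral_inner_primitive_nonneg hA hA0 hg1
      have hi2 : MemLp (fun t => i (y.fst t)) 2 μ := i.comp_memLp' (Lp.memLp y.fst)
      have hsq : ∫ t, ‖i (y.fst t)‖ ^ 2 ∂μ ≤ 0 := by
        have h1 : ∫ t, ⟪(pathData μ i A (0, y.fst)).fst t, y.fst t⟫_ℝ ∂μ =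
            ∫ t, (‖i (y.fst t)‖ ^ 2 + ⟪A (y.fst t), primitive μ y.fst t⟫_ℝ) ∂μ := by
          refine integral_congr_ae ?_
          filter_upwards [coeFn_pathData_fst (i := i) (A := A) μ (0, y.fst)] with t ht
          rw [ht, inner_add_left, ContinuousLinearMap.adjoint_inner_left,
            real_inner_self_eq_norm_sq, pathOf_apply, zero_add, hA]
        have h2 : ∫ t, ⟪(pathData μ i A (0, y.fst)).fst t, y.fst t⟫_ℝ ∂μ = 0 := h
        rw [h1, integral_add (hi2.integrable_norm_pow (by simp))
          (integrable_inner_primitive (A.integrable_comp hg1) hg1)] at h2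
        linarith
      have hz := (integral_eq_zero_iff_of_nonneg (fun t => by positivity)
        (hi2.integrable_norm_pow (by simp))).1
        (le_antisymm hsq (integral_nonneg fun t => by positivity))
      refine Lp.ext ?_
      filter_upwards [hz, Lp.coeFn_zero V 2 μ] with t ht h0
      rw [h0]
      have : i (y.fst t) = 0 := by simpa using ht
      exact hi (by rw [this, Pi.zero_apply, map_zero])
    have hh : y.snd = 0 := by
      refine hdense.eq_zero_of_inner_right ℝ fun v => ?_
      have h := (WithLp.prod_inner_apply _ _).symm.trans (hy' (v, 0))
      change ⟪(pathData μ i A (v, 0)).fst, y.fst⟫_ℝ + ⟪i v, y.snd⟫_ℝ = 0 at h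
      rwa [hg, inner_zero_right, zero_add] at h
    exact (WithLp.equiv 2 _).injective (Prod.ext hg hh)
  have h2 := (Submodule.dense_iff_topologicalClosure_eq_top.2
    (Submodule.topologicalClosure_eq_top_iff.2 key))
  rw [DenseRange, ← LinearMap.coe_range]
  exact h2

/-- **Existence** for the degenerate evolution equation `(i† i B)' + A B = f`, `i B(0) = b₀`, in
the form integrated over time, with `i B` continuous. -/
theorem exists_integrated_solution (hi : Function.Injective i) (hdense : DenseRange i)
    (hA : ∀ u v, ⟪A u, v⟫_ℝ = ⟪A v, u⟫_ℝ) (hA0 : ∀ u, 0 ≤ ⟪A u, u⟫_ℝ)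
    (hc0 : 0 < c) (hc : ∀ u, c * ‖u‖ ^ 2 ≤ ⟪A u, u⟫_ℝ + ‖i u‖ ^ 2)
    (f : Lp V 2 μ) (b₀ : H) :
    ∃ (B : Lp V 2 μ) (b : ℝ →ᵇ H), (∀ᵐ t ∂μ, b t = i (B t)) ∧
      ∀ t, i.adjoint (b t) + primitive μ (fun s => A (B s)) t =
        i.adjoint b₀ + primitive μ f t := by
  obtain ⟨C, hC0, hC⟩ := exists_energy_bound hA hA0 hc0 hc μ
  have hd := denseRange_pathData μ hi hdense hA hA0
  have hbound : ∀ p, ‖pathSolution μ i p‖ ≤ √C * ‖pathData μ i A p‖ := by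
    intro p
    have hB : MemLp (pathOf μ p) 2 μ :=
      (Lp.memLp (pathLp μ p)).ae_eq (coeFn_pathLp μ p)
    obtain ⟨h1, h2⟩ := hC p.2 (pathData μ i A p).fst (pathOf μ p) p.1 (Lp.memLp _) (Lp.memLp _)
      hB (pathOf_apply μ p) (coeFn_pathData_fst μ p)
    have h3 : C * ((eLpNorm (pathData μ i A p).fst 2 μ).toReal ^ 2 + ‖i p.1‖ ^ 2) =
        (√C * ‖pathData μ i A p‖) ^ 2 := by
      rw [mul_pow, Real.sq_sqrt hC0, WithLp.prod_norm_sq_eq_of_L2, pathData_snd, Lp.norm_def]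
    rw [h3] at h1 h2
    have h0 : 0 ≤ √C * ‖pathData μ i A p‖ := by positivity
    refine max_le ?_ ?_
    · refine le_trans (le_of_eq ?_) ((sq_le_sq₀ ENNReal.toReal_nonneg h0).1 h1)
      rw [← eLpNorm_congr_ae (coeFn_pathLp μ p)]
      rfl
    · exact (BoundedContinuousFunction.norm_le h0).2 fun t =>
        (sq_le_sq₀ (norm_nonneg _) h0).1 (h2 t)
  set e := (pathSolution μ i).extendOfNorm (pathData μ i A) with he
  have heq : ∀ p, e (pathData μ i A p) = pathSolution μ i p := fun p =>
    LinearMap.extendOfNorm_eq hd ⟨_, hbound⟩ p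
  have hmain : ∀ y : WithLp 2 (Lp V 2 μ × H),
      BoundedContinuousFunction.toLp 2 μ ℝ (e y).2 = i.compLpL 2 μ (e y).1 ∧
      ∀ t, i.adjoint ((e y).2 t) + primitiveL μ (A.compLpL 2 μ (e y).1) t =
        i.adjoint y.snd + primitiveL μ y.fst t := by
    intro y
    have heval : ∀ t : ℝ, Continuous fun g : ℝ →ᵇ V => g t :=
      fun t => (BoundedContinuousFunction.evalCLM ℝ t).continuous
    have hevalH : ∀ t : ℝ, Continuous fun g : ℝ →ᵇ H => g t :=
      fun t => (BoundedContinuousFunction.evalCLM ℝ t).continuous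
    refine hd.induction_on
      (p := fun y => BoundedContinuousFunction.toLp 2 μ ℝ (e y).2 = i.compLpL 2 μ (e y).1 ∧
        ∀ t, i.adjoint ((e y).2 t) + primitiveL μ (A.compLpL 2 μ (e y).1) t =
          i.adjoint y.snd + primitiveL μ y.fst t) y ?_ ?_
    · simp only [ofPred_and, ofPred_forall]
      refine IsClosed.inter (isClosed_eq (by fun_prop) (by fun_prop))
        (isClosed_iInter fun t => isClosed_eq ?_ ?_)
      · exact (i.adjoint.continuous.comp ((hevalH t).comp (by fun_prop))).add
          ((heval t).comp (by fun_prop))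
      · exact (i.adjoint.continuous.comp (WithLp.sndL 2 ℝ _ _).continuous).add
          ((heval t).comp ((primitiveL μ).continuous.comp (WithLp.fstL 2 ℝ _ _).continuous))
    · intro p
      rw [heq]
      refine ⟨?_, fun t => ?_⟩
      · refine Lp.ext ?_
        filter_upwards [BoundedContinuousFunction.coeFn_toLp 2 μ ℝ (pathSolution μ i p).2,
          i.coeFn_compLpL (p := 2) (pathSolution μ i p).1, coeFn_pathLp μ p] with t h1 h2 h3
        rw [h1, h2]
        exact congrArg i h3.symm
      · have hw1 := integrable_coeFn_Lp_two p.2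
        rw [pathData_fst, map_add, BoundedContinuousFunction.add_apply, ← add_assoc]
        refine congrArg₂ (· + ·) ?_ rfl
        rw [primitiveL_apply, primitive_congr ((i.adjoint ∘L i).coeFn_compLpL (p := 2) p.2),
          (i.adjoint ∘L i).primitive_comp hw1, pathData_snd]
        change i.adjoint (i (p.1 + primitive μ p.2 t)) = _
        simp
  obtain ⟨h1, h2⟩ := hmain (WithLp.toLp 2 (f, b₀))
  set B := (e (WithLp.toLp 2 (f, b₀))).1
  set b := (e (WithLp.toLp 2 (f, b₀))).2
  refine ⟨B, b, ?_, fun t => ?_⟩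
  · filter_upwards [BoundedContinuousFunction.coeFn_toLp 2 μ ℝ b, i.coeFn_compLpL (p := 2) B]
      with t h3 h4
    rw [← h3, h1, h4]
  · have h := h2 t
    rw [primitiveL_apply, primitive_congr (A.coeFn_compLpL (p := 2) B)] at h
    exact h

/-- **Uniqueness** for `(i† i B)' + A B = 0`, `i B(0) = 0`: test the equation integrated in time
with `B`. -/
theorem eq_zero_of_integrated_equation (hi : Function.Injective i)
    (hA : ∀ u v, ⟪A u, v⟫_ℝ = ⟪A v, u⟫_ℝ) (hA0 : ∀ u, 0 ≤ ⟪A u, u⟫_ℝ) (B : Lp V 2 μ)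
    (h : ∀ᵐ t ∂μ, i.adjoint (i (B t)) + primitive μ (fun s => A (B s)) t = 0) : B = 0 := by
  have hi2 : MemLp (fun t => i (B t)) 2 μ := i.comp_memLp' (Lp.memLp B)
  have hsq := integral_norm_sq_le (f := fun _ => 0) (b := fun t => i (B t)) hA hA0 (0 : H)
    MemLp.zero (Lp.memLp B) (Filter.Eventually.of_forall fun _ => rfl)
    (h.mono fun t ht => by rw [ht]; simp [primitive])
  have hz := (integral_eq_zero_iff_of_nonneg (fun t => by positivity)
    (hi2.integrable_norm_pow (by simp))).1
    (le_antisymm (by simpa using hsq) (integral_nonneg fun t => by positivity))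
  refine Lp.ext ?_
  filter_upwards [hz, Lp.coeFn_zero V 2 μ] with t ht h0
  rw [h0]
  have : i (B t) = 0 := by simpa using ht
  exact hi (by rw [this, Pi.zero_apply, map_zero])

end Evolution

/-! ### Test fields in `H₀(curl; Ω)` -/

section TestFields

variable {Ω : Opens E3}

theorem memLp_testField {F : Type*} [NormedAddCommGroup F] [NormedSpace ℝ F] (φ : 𝓓(Ω, F)) :
    MemLp φ 2 (volume.restrict (Ω : Set E3)) :=
  φ.continuous.memLp_of_hasCompactSupport φ.hasCompactSupport

theorem memLp_classicalCurl (φ : 𝓓(Ω, E3)) :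
    MemLp (classicalCurl φ) 2 (volume.restrict (Ω : Set E3)) :=
  (continuous_classicalCurl φ).memLp_of_hasCompactSupport (hasCompactSupport_classicalCurl φ)

/-- The `j`-th component of a test field. -/
noncomputable def testComponent (χ : 𝓓(Ω, E3)) (j : Fin 3) : 𝓓(Ω, ℝ) where
  toFun x := χ x j
  contDiff' := (EuclideanSpace.proj (𝕜 := ℝ) j).contDiff.comp χ.contDiff
  hasCompactSupport' := χ.hasCompactSupport.comp_left (g := fun y : E3 => y j) rfl
  tsupport_subset' :=
    (tsupport_comp_subset (g := fun y : E3 => y j) rfl χ).trans χ.tsupport_subset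

theorem fderiv_testComponent (χ : 𝓓(Ω, E3)) (j : Fin 3) (x v : E3) :
    fderiv ℝ (testComponent χ j) x v = (fderiv ℝ χ x v) j := by
  have h : HasFDerivAt χ (fderiv ℝ χ x) x :=
    (χ.contDiff.differentiable (by simp) x).hasFDerivAt
  have h2 := ((EuclideanSpace.proj (𝕜 := ℝ) j).hasFDerivAt (x := χ x)).comp x h
  have h3 : fderiv ℝ (testComponent χ j) x = _ := h2.fderiv
  rw [h3]
  rfl

theorem memLp_fderiv_apply {F : Type*} [NormedAddCommGroup F] [NormedSpace ℝ F] (φ : 𝓓(Ω, F))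
    (v : E3) : MemLp (fun x => fderiv ℝ φ x v) 2 (volume.restrict (Ω : Set E3)) :=
  ((φ.contDiff.continuous_fderiv (by simp)).clm_apply continuous_const).memLp_of_hasCompactSupport
    (φ.hasCompactSupport.fderiv_apply ℝ v)

/-- A test field belongs to `H¹(Ω)³`, its weak partial derivatives being the classical ones. -/
theorem isWeakGradient_testField (φ : 𝓓(Ω, E3)) :
    IsWeakGradient Ω (memLp_testField φ).toLp
      fun i => (memLp_fderiv_apply φ (basisVec i)).toLp := by
  intro i ψ
  have h1 : ∫ x in (Ω : Set E3), (fderiv ℝ ψ x (basisVec i)) • (memLp_testField φ).toLp φ x =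
      ∫ x in (Ω : Set E3), (fderiv ℝ ψ x (basisVec i)) • φ x := by
    refine integral_congr_ae ?_
    filter_upwards [(memLp_testField φ).coeFn_toLp] with x hx
    rw [hx]
  have h2 : ∫ x in (Ω : Set E3), ψ x • (memLp_fderiv_apply φ (basisVec i)).toLp _ x =
      ∫ x in (Ω : Set E3), ψ x • fderiv ℝ φ x (basisVec i) := by
    refine integral_congr_ae ?_
    filter_upwards [(memLp_fderiv_apply φ (basisVec i)).coeFn_toLp] with x hx
    rw [hx]
  have z : ∀ x, x ∉ (Ω : Set E3) → φ x = 0 ∧ ψ x = 0 := fun x hx =>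
    ⟨image_eq_zero_of_notMem_tsupport fun h => hx (φ.tsupport_subset h),
      image_eq_zero_of_notMem_tsupport fun h => hx (ψ.tsupport_subset h)⟩
  rw [h1, h2, setIntegral_eq_integral_of_forall_compl_eq_zero fun x hx => by simp [(z x hx).1],
    setIntegral_eq_integral_of_forall_compl_eq_zero fun x hx => by simp [(z x hx).2]]
  have cφ := φ.contDiff.continuous_fderiv (by simp)
  have cψ := ψ.contDiff.continuous_fderiv (by simp)
  have h := integral_smul_fderiv_eq_neg_fderiv_smul_of_integrable (μ := volume) (𝕜 := ℝ)
    (f := ψ) (g := φ) (v := basisVec i)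
    (((cψ.clm_apply continuous_const).smul φ.continuous).integrable_of_hasCompactSupport
      φ.hasCompactSupport.smul_left)
    ((ψ.continuous.smul (cφ.clm_apply continuous_const)).integrable_of_hasCompactSupport
      ψ.hasCompactSupport.smul_right)
    ((ψ.continuous.smul φ.continuous).integrable_of_hasCompactSupport φ.hasCompactSupport.smul_left)
    (fun x _ => ψ.contDiff.differentiable (by simp) x)
    (fun x _ => φ.contDiff.differentiable (by simp) x)
  rw [h, neg_neg]

/-- Since test fields belong to `H¹(Ω)³`, the boundary condition contains the definition of the
weak curl. -/
theorem HasZeroTangentialTrace.isWeakCurl {A C : L2Field Ω} (h : HasZeroTangentialTrace Ω A C) :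
    IsWeakCurl Ω A C := by
  intro φ
  have h1 := h _ _ (isWeakGradient_testField φ)
  have h2 : ∫ x in (Ω : Set E3), inner ℝ (C x) ((memLp_testField φ).toLp φ x) =
      ∫ x in (Ω : Set E3), inner ℝ (C x) (φ x) := by
    refine integral_congr_ae ?_
    filter_upwards [(memLp_testField φ).coeFn_toLp] with x hx
    rw [hx]
  rw [← h2, h1]
  refine integral_congr_ae ?_
  filter_upwards [(memLp_fderiv_apply φ (basisVec 0)).coeFn_toLp,
    (memLp_fderiv_apply φ (basisVec 1)).coeFn_toLp,
    (memLp_fderiv_apply φ (basisVec 2)).coeFn_toLp] with x h0 h1 h2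
  simp only [classicalCurl, curlOf, h0, h1, h2]

theorem inner_curlOf_eq_sum (J : Fin 3 → E3) (u : E3) :
    inner ℝ (curlOf J) u = (J 1 2 * u 0 - J 2 1 * u 0) + (J 2 0 * u 1 - J 0 2 * u 1) +
      (J 0 1 * u 2 - J 1 0 * u 2) := by
  simp [PiLp.inner_apply, Fin.sum_univ_three, curlOf]
  ring

theorem integral_sub_add_sub_add_sub {α : Type*} [MeasurableSpace α] {μ : Measure α}
    {a b c d e f : α → ℝ} (ha : Integrable a μ) (hb : Integrable b μ) (hc : Integrable c μ)
    (hd : Integrable d μ) (he : Integrable e μ) (hf : Integrable f μ) :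
    ∫ x, ((a x - b x) + (c x - d x) + (e x - f x)) ∂μ =
      (∫ x, a x ∂μ - ∫ x, b x ∂μ) + (∫ x, c x ∂μ - ∫ x, d x ∂μ) +
        (∫ x, e x ∂μ - ∫ x, f x ∂μ) := by
  have h1 : Integrable (fun x => a x - b x) μ := ha.sub hb
  have h2 : Integrable (fun x => c x - d x) μ := hc.sub hd
  have h3 : Integrable (fun x => e x - f x) μ := he.sub hf
  have h4 : Integrable (fun x => (a x - b x) + (c x - d x)) μ := h1.add h2
  rw [integral_add h4 h3, integral_add h1 h2, integral_sub ha hb, integral_sub hc hd,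
    integral_sub he hf]

/-- Green's formula `(∇ × χ, u) = (χ, ∇ × u)` for a test field `χ` and `u ∈ H¹(Ω)³`. -/
theorem integral_classicalCurl_inner (χ : 𝓓(Ω, E3)) {u : L2Field Ω} {G : Fin 3 → L2Field Ω}
    (h : IsWeakGradient Ω u G) :
    ∫ x in (Ω : Set E3), inner ℝ (classicalCurl χ x) (u x) =
      ∫ x in (Ω : Set E3), inner ℝ (χ x) (curlOf fun i => G i x) := by
  set μ := (volume : Measure E3).restrict (Ω : Set E3)
  have comp : ∀ (w : L2Field Ω) (k : Fin 3), MemLp (fun x => w x k) 2 μ := fun w k =>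
    (EuclideanSpace.proj (𝕜 := ℝ) k).comp_memLp' (Lp.memLp w)
  have hχ : ∀ k : Fin 3, MemLp (fun x => χ x k) 2 μ := fun k => memLp_testField (testComponent χ k)
  have hdχ : ∀ i j : Fin 3, MemLp (fun x => (fderiv ℝ χ x (basisVec i)) j) 2 μ := fun i j =>
    (EuclideanSpace.proj (𝕜 := ℝ) j).comp_memLp' (memLp_fderiv_apply χ (basisVec i))
  have I1 : ∀ i j k : Fin 3, Integrable (fun x => (fderiv ℝ χ x (basisVec i)) j * u x k) μ :=
    fun i j k => (hdχ i j).integrable_mul (comp u k)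
  have I2 : ∀ i j k : Fin 3, Integrable (fun x => χ x j * G i x k) μ :=
    fun i j k => (hχ j).integrable_mul (comp (G i) k)
  -- the definition of the weak gradient, in components
  have key : ∀ i j k : Fin 3, ∫ x, (fderiv ℝ χ x (basisVec i)) j * u x k ∂μ =
      -∫ x, χ x j * G i x k ∂μ := by
    intro i j k
    have h1 := congrArg (EuclideanSpace.proj (𝕜 := ℝ) k) (h i (testComponent χ j))
    have J1 : Integrable (fun x => (fderiv ℝ (testComponent χ j) x (basisVec i)) • u x) μ := by
      simp_rw [fderiv_testComponent]
      exact memLp_one_iff_integrable.1 ((Lp.memLp u).smul (hdχ i j))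
    have J2 : Integrable (fun x => testComponent χ j x • G i x) μ :=
      memLp_one_iff_integrable.1 ((Lp.memLp (G i)).smul (hχ j))
    rw [map_neg, ← ContinuousLinearMap.integral_comp_comm _ J1,
      ← ContinuousLinearMap.integral_comp_comm _ J2] at h1
    simp only [fderiv_testComponent, map_smul, smul_eq_mul, PiLp.proj_apply] at h1
    exact h1
  have e1 : ∀ x, inner ℝ (classicalCurl χ x) (u x) = _ := fun x => inner_curlOf_eq_sum _ _
  have e2 : ∀ x, inner ℝ (χ x) (curlOf fun i => G i x) =
      (χ x 0 * G 1 x 2 - χ x 0 * G 2 x 1) + (χ x 1 * G 2 x 0 - χ x 1 * G 0 x 2) +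
      (χ x 2 * G 0 x 1 - χ x 2 * G 1 x 0) := fun x => by
    rw [real_inner_comm, inner_curlOf_eq_sum]
    ring
  simp_rw [e1, e2]
  rw [integral_sub_add_sub_add_sub (I1 1 2 0) (I1 2 1 0) (I1 2 0 1) (I1 0 2 1) (I1 0 1 2)
      (I1 1 0 2),
    integral_sub_add_sub_add_sub (I2 1 0 2) (I2 2 0 1) (I2 2 1 0) (I2 0 1 2) (I2 0 2 1) (I2 1 2 0)]
  simp only [key]
  ring

/-- A test field `χ`, as the element `(χ, ∇ × χ)` of `H₀(curl; Ω)`. -/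
noncomputable def testFieldHCurl (χ : 𝓓(Ω, E3)) : HCurlZero Ω :=
  ⟨WithLp.toLp 2 ((memLp_testField χ).toLp, (memLp_classicalCurl χ).toLp), by
    have h : HasZeroTangentialTrace Ω (memLp_testField χ).toLp (memLp_classicalCurl χ).toLp := by
      intro u G hG
      refine Eq.trans ?_ ((integral_classicalCurl_inner χ hG).trans ?_)
      · refine integral_congr_ae ?_
        filter_upwards [(memLp_classicalCurl χ).coeFn_toLp] with x hx
        rw [hx]
      · refine integral_congr_ae ?_
        filter_upwards [(memLp_testField χ).coeFn_toLp] with x hx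
        rw [hx]
    exact ⟨h.isWeakCurl, h⟩⟩

theorem toField_testFieldHCurl (χ : 𝓓(Ω, E3)) :
    toField (testFieldHCurl χ) = (memLp_testField χ).toLp := rfl

theorem curl_testFieldHCurl (χ : 𝓓(Ω, E3)) :
    curl (testFieldHCurl χ) = (memLp_classicalCurl χ).toLp := rfl

/-- The gradient of a test function, as a test field. -/
noncomputable def testGradient (φ : 𝓓(Ω, ℝ)) : 𝓓(Ω, E3) where
  toFun := gradient φ
  contDiff' := by
    have h : ContDiff ℝ ((⊤ : ℕ∞) : WithTop ℕ∞) (fderiv ℝ φ) := φ.contDiff.fderiv_right le_rfl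
    exact (InnerProductSpace.toDual ℝ E3).symm.toContinuousLinearEquiv.contDiff.comp h
  hasCompactSupport' := (φ.hasCompactSupport.fderiv ℝ).comp_left (map_zero _)
  tsupport_subset' :=
    (tsupport_comp_subset (map_zero (InnerProductSpace.toDual ℝ E3).symm) (fderiv ℝ φ)).trans
      ((tsupport_fderiv_subset ℝ).trans φ.tsupport_subset)

theorem testGradient_apply (φ : 𝓓(Ω, ℝ)) (x : E3) : testGradient φ x = gradient φ x := rfl

/-- `∇ × ∇φ = 0`, by the symmetry of second derivatives. -/
theorem classicalCurl_testGradient (φ : 𝓓(Ω, ℝ)) (x : E3) :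
    classicalCurl (testGradient φ) x = 0 := by
  have hcomp : ∀ j : Fin 3, ∀ y, testGradient φ y j = fderiv ℝ φ y (basisVec j) := by
    intro j y
    have : inner ℝ (gradient φ y) (basisVec j) = fderiv ℝ φ y (basisVec j) := by
      rw [gradient, InnerProductSpace.toDual_symm_apply]
    rw [← this, testGradient_apply, basisVec, EuclideanSpace.inner_single_right]
    simp
  have hd2 : DifferentiableAt ℝ (fderiv ℝ φ) x :=
    ((φ.contDiff.fderiv_right (m := ((⊤ : ℕ∞) : WithTop ℕ∞)) le_rfl).differentiable (by simp)) x
  have hder : ∀ i j : Fin 3, (fderiv ℝ (testGradient φ) x (basisVec i)) j =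
      fderiv ℝ (fderiv ℝ φ) x (basisVec i) (basisVec j) := by
    intro i j
    rw [← fderiv_testComponent]
    have : (testComponent (testGradient φ) j : E3 → ℝ) = fun y => fderiv ℝ φ y (basisVec j) :=
      funext (hcomp j)
    rw [this, fderiv_clm_apply hd2 (differentiableAt_const _)]
    simp
  have hsymm : ∀ u v, fderiv ℝ (fderiv ℝ φ) x u v = fderiv ℝ (fderiv ℝ φ) x v u := by
    have : IsSymmSndFDerivAt ℝ φ x :=
      φ.contDiff.contDiffAt.isSymmSndFDerivAt (by
        simpa using WithTop.coe_le_coe.2 (le_top : (2 : ℕ∞) ≤ ⊤))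
    exact fun u v => this u v
  ext k
  fin_cases k <;>
    simp [classicalCurl, curlOf, hder, hsymm (basisVec 2), hsymm (basisVec 1) (basisVec 0)]

theorem curl_testFieldHCurl_testGradient (φ : 𝓓(Ω, ℝ)) :
    curl (testFieldHCurl (testGradient φ)) = 0 := by
  rw [curl_testFieldHCurl]
  refine Lp.ext ?_
  filter_upwards [(memLp_classicalCurl (testGradient φ)).coeFn_toLp,
    Lp.coeFn_zero E3 2 (volume.restrict (Ω : Set E3))] with x h1 h2
  rw [h1, h2, classicalCurl_testGradient]
  rfl

/-- Test fields separate the points of `L²(Ω)³`. -/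
theorem eq_zero_of_forall_testField {h : L2Field Ω}
    (hh : ∀ φ : 𝓓(Ω, E3), ∫ x in (Ω : Set E3), inner ℝ (h x) (φ x) = 0) : h = 0 := by
  have key := Ω.isOpen.ae_eq_zero_of_integral_contDiff_smul_eq_zero
    (μ := volume.restrict (Ω : Set E3)) (f := h)
    (((Lp.memLp h).locallyIntegrable one_le_two).locallyIntegrableOn _) (fun g hg hgc hgs => by
      refine ext_inner_left ℝ fun c => ?_
      have hgL : MemLp g 2 (volume.restrict (Ω : Set E3)) :=
        hg.continuous.memLp_of_hasCompactSupport hgc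
      have hi : Integrable (fun x => g x • h x) (volume.restrict (Ω : Set E3)) :=
        memLp_one_iff_integrable.1 ((Lp.memLp h).smul hgL)
      rw [inner_zero_right]
      refine ((innerSL ℝ c).integral_comp_comm hi).symm.trans ?_
      let φ : 𝓓(Ω, E3) :=
        { toFun := fun x => g x • c
          contDiff' := hg.smul contDiff_const
          hasCompactSupport' := hgc.smul_right
          tsupport_subset' := (tsupport_smul_subset_left g _).trans hgs }
      rw [← hh φ]
      refine integral_congr_ae (Filter.Eventually.of_forall fun x => ?_)
      change ⟪c, g x • h x⟫_ℝ = ⟪h x, g x • c⟫_ℝ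
      rw [inner_smul_right, inner_smul_right, real_inner_comm])
  refine Lp.ext ?_
  filter_upwards [key, ae_restrict_mem Ω.isOpen.measurableSet,
    Lp.coeFn_zero E3 2 (volume.restrict (Ω : Set E3))] with x h1 h2 h3
  rw [h1 h2, h3]
  rfl

theorem toField_injective : Function.Injective (toField (Ω := Ω)) := by
  refine (injective_iff_map_eq_zero _).2 fun v hv => ?_
  have hfst : v.1.fst = 0 := hv
  have hsnd : v.1.snd = 0 := eq_zero_of_forall_testField fun φ => by
    rw [v.2.1 φ, hfst, integral_inner_zero]
  exact Subtype.ext ((WithLp.equiv 2 _).injective (Prod.ext hfst hsnd))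

theorem denseRange_toField : DenseRange (toField (Ω := Ω)) := by
  have key : (LinearMap.range (toField (Ω := Ω)).toLinearMap)ᗮ = ⊥ := by
    rw [Submodule.eq_bot_iff]
    intro h hh
    refine eq_zero_of_forall_testField fun φ => ?_
    have h1 : ⟪toField (testFieldHCurl φ), h⟫_ℝ = 0 :=
      (Submodule.mem_orthogonal _ _).1 hh _ ⟨_, rfl⟩
    rw [real_inner_comm, L2.inner_def, toField_testFieldHCurl] at h1
    rw [← h1]
    refine integral_congr_ae ?_
    filter_upwards [(memLp_testField φ).coeFn_toLp] with x hx
    rw [hx]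
  have h2 := (Submodule.dense_iff_topologicalClosure_eq_top.2
    (Submodule.topologicalClosure_eq_top_iff.2 key))
  rw [LinearMap.coe_range] at h2
  exact h2

/-- `(g, w)` for a fixed square integrable field `w` depends continuously on `g`. -/
theorem continuous_integral_inner {w : E3 → E3}
    (hw : MemLp w 2 (volume.restrict (Ω : Set E3))) :
    Continuous fun g : L2Field Ω => ∫ x in (Ω : Set E3), inner ℝ (g x) (w x) := by
  have h : (fun g : L2Field Ω => ∫ x in (Ω : Set E3), inner ℝ (g x) (w x)) =
      fun g : L2Field Ω => ⟪g, hw.toLp⟫_ℝ := by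
    funext g
    rw [L2.inner_def]
    refine integral_congr_ae ?_
    filter_upwards [hw.coeFn_toLp] with x hx
    rw [hx]
  rw [h]
  exact continuous_id.inner continuous_const

theorem isClosed_HCurlZero : IsClosed (HCurlZero Ω : Set (WithLp 2 (L2Field Ω × L2Field Ω))) := by
  have hf : Continuous fun p : WithLp 2 (L2Field Ω × L2Field Ω) => p.fst :=
    (WithLp.fstL 2 ℝ _ _).continuous
  have hs : Continuous fun p : WithLp 2 (L2Field Ω × L2Field Ω) => p.snd :=
    (WithLp.sndL 2 ℝ _ _).continuous
  have h : (HCurlZero Ω : Set (WithLp 2 (L2Field Ω × L2Field Ω))) =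
      {p | IsWeakCurl Ω p.fst p.snd} ∩ {p | HasZeroTangentialTrace Ω p.fst p.snd} := rfl
  rw [h]
  simp only [IsWeakCurl, HasZeroTangentialTrace, ofPred_forall]
  refine IsClosed.inter (isClosed_iInter fun φ => isClosed_eq ?_ ?_)
    (isClosed_iInter fun φ => isClosed_iInter fun G => isClosed_iInter fun _ => isClosed_eq ?_ ?_)
  · exact (continuous_integral_inner (memLp_testField φ)).comp hs
  · exact (continuous_integral_inner (memLp_classicalCurl φ)).comp hf
  · exact (continuous_integral_inner (Lp.memLp φ)).comp hs
  · exact (continuous_integral_inner (memLp_curlOf G)).comp hf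

instance instCompleteSpaceHCurlZero : CompleteSpace (HCurlZero Ω) :=
  isClosed_HCurlZero.completeSpace_coe

end TestFields

/-! ### Weak time derivatives -/

section WeakTimeDerivative

variable {T : ℝ} {W : Type*} [NormedAddCommGroup W] [NormedSpace ℝ W]

theorem primitive_restrict_Ioo_zero (g : ℝ → W) :
    primitive (volume.restrict (Ioo 0 T)) g 0 = 0 := by
  rw [primitive, Measure.restrict_restrict measurableSet_Iic]
  have : Iic (0 : ℝ) ∩ Ioo 0 T = ∅ := by
    ext x
    simp only [mem_inter_iff, mem_Iic, mem_Ioo, mem_empty_iff_false, iff_false]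
    intro h
    linarith [h.1, h.2.1]
  simp [this]

theorem MeasureTheory.Integrable.smul_of_hasCompactSupport {μ : Measure ℝ} {u : ℝ → W}
    (hu : Integrable u μ) {g : ℝ → ℝ} (hg : Continuous g) (hgc : HasCompactSupport g) :
    Integrable (fun t => g t • u t) μ := by
  obtain ⟨C, hC⟩ := hgc.exists_bound_of_continuous hg
  exact hu.bdd_smul C hg.aestronglyMeasurable (Filter.Eventually.of_forall hC)

theorem integrable_testFunction_smul (ψ : 𝓓((⟨Ioo 0 T, isOpen_Ioo⟩ : Opens ℝ), ℝ)) {g : ℝ → W}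
    {μ : Measure ℝ} (hg : Integrable g μ) : Integrable (fun t => ψ t • g t) μ :=
  hg.smul_of_hasCompactSupport ψ.continuous ψ.hasCompactSupport

theorem continuous_deriv_testFunction (ψ : 𝓓((⟨Ioo 0 T, isOpen_Ioo⟩ : Opens ℝ), ℝ)) :
    Continuous (deriv ψ) := ψ.contDiff.continuous_deriv (by simp)

theorem integrable_deriv_testFunction_smul (ψ : 𝓓((⟨Ioo 0 T, isOpen_Ioo⟩ : Opens ℝ), ℝ))
    {g : ℝ → W} {μ : Measure ℝ} (hg : Integrable g μ) : Integrable (fun t => deriv ψ t • g t) μ :=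
  hg.smul_of_hasCompactSupport (continuous_deriv_testFunction ψ) ψ.hasCompactSupport.deriv

theorem setIntegral_Ici_deriv_testFunction (ψ : 𝓓((⟨Ioo 0 T, isOpen_Ioo⟩ : Opens ℝ), ℝ)) (s : ℝ) :
    ∫ t in Ici s, deriv ψ t ∂(volume.restrict (Ioo 0 T)) = -ψ s := by
  have hz : ∀ x, x ∉ Ioo 0 T → deriv ψ x = 0 := fun x hx =>
    image_eq_zero_of_notMem_tsupport fun h =>
      hx (ψ.tsupport_subset (closure_minimal (support_deriv_subset (f := ψ)) isClosed_closure h))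
  rw [integral_Ici_eq_integral_Ioi, Measure.restrict_restrict measurableSet_Ioi, inter_comm,
    ← Measure.restrict_restrict measurableSet_Ioo,
    setIntegral_eq_integral_of_forall_compl_eq_zero hz]
  exact ψ.hasCompactSupport.integral_Ioi_deriv_eq (ψ.contDiff.of_le (by simp)) s

theorem integral_deriv_testFunction (ψ : 𝓓((⟨Ioo 0 T, isOpen_Ioo⟩ : Opens ℝ), ℝ)) :
    ∫ t in Ioo 0 T, deriv ψ t = 0 := by
  have h := setIntegral_Ici_deriv_testFunction ψ 0
  have h0 : ψ 0 = 0 := image_eq_zero_of_notMem_tsupport fun h => by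
    have := ψ.tsupport_subset h
    exact lt_irrefl _ this.1
  rw [Measure.restrict_restrict measurableSet_Ici,
    inter_eq_self_of_subset_right (Ioo_subset_Ioi_self.trans Ioi_subset_Ici_self), h0,
    neg_zero] at h
  exact h

/-- The weak derivative of a primitive, by Fubini. -/
theorem integral_deriv_smul_primitive [CompleteSpace W]
    (ψ : 𝓓((⟨Ioo 0 T, isOpen_Ioo⟩ : Opens ℝ), ℝ)) {g : ℝ → W}
    (hg : Integrable g (volume.restrict (Ioo 0 T))) :
    ∫ t in Ioo 0 T, deriv ψ t • primitive (volume.restrict (Ioo 0 T)) g t =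
      -∫ t in Ioo 0 T, ψ t • g t := by
  set μ := (volume : Measure ℝ).restrict (Ioo 0 T)
  have hψ : Integrable (deriv ψ) μ :=
    ((continuous_deriv_testFunction ψ).integrable_of_hasCompactSupport
      ψ.hasCompactSupport.deriv).restrict
  have hk : Integrable (fun z : ℝ × ℝ => deriv ψ z.1 • g z.2) (μ.prod μ) :=
    Integrable.op_fst_snd (op := fun (x : ℝ) (y : W) => x • y) continuous_smul
      ⟨1, fun x y => by simp [norm_smul]⟩ hψ hg
  have hD : MeasurableSet {z : ℝ × ℝ | z.2 ≤ z.1} := measurableSet_le measurable_snd measurable_fst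
  have e1 : ∀ t, deriv ψ t • primitive μ g t =
      ∫ s, {z : ℝ × ℝ | z.2 ≤ z.1}.indicator (fun z => deriv ψ z.1 • g z.2) (t, s) ∂μ := by
    intro t
    rw [primitive, ← integral_smul, ← integral_indicator measurableSet_Iic]
    rfl
  have e2 : ∀ s, -(ψ s • g s) =
      ∫ t, {z : ℝ × ℝ | z.2 ≤ z.1}.indicator (fun z => deriv ψ z.1 • g z.2) (t, s) ∂μ := by
    intro s
    rw [← neg_smul, ← setIntegral_Ici_deriv_testFunction, ← integral_smul_const,
      ← integral_indicator measurableSet_Ici]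
    rfl
  rw [← integral_neg]
  simp_rw [e1, e2]
  exact integral_integral_swap (f := fun t s =>
    {z : ℝ × ℝ | z.2 ≤ z.1}.indicator (fun z => deriv ψ z.1 • g z.2) (t, s)) (hk.indicator hD)

theorem exists_contDiff_integral_eq_one (hT : 0 < T) :
    ∃ ρ : ℝ → ℝ, ContDiff ℝ ((⊤ : ℕ∞) : WithTop ℕ∞) ρ ∧ HasCompactSupport ρ ∧
      tsupport ρ ⊆ Ioo 0 T ∧ ∫ t, ρ t = 1 := by
  let f : ContDiffBump (T / 2) := ⟨T / 8, T / 4, by linarith, by linarith⟩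
  refine ⟨f.normed volume, f.contDiff_normed, f.hasCompactSupport_normed, ?_, f.integral_normed⟩
  rw [f.tsupport_normed_eq, Real.closedBall_eq_Icc]
  exact Icc_subset_Ioo (by simp only [f]; linarith) (by simp only [f]; linarith)

/-- A smooth function with compact support in `(0, T)` and integral zero has a primitive with
compact support in `(0, T)`. -/
theorem exists_testFunction_deriv_eq {χ : ℝ → ℝ} (hχ : ContDiff ℝ ((⊤ : ℕ∞) : WithTop ℕ∞) χ)
    (hc : HasCompactSupport χ) (hs : tsupport χ ⊆ Ioo 0 T) (h0 : ∫ t, χ t = 0) :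
    ∃ ψ : 𝓓((⟨Ioo 0 T, isOpen_Ioo⟩ : Opens ℝ), ℝ), ∀ t, deriv ψ t = χ t := by
  rcases (tsupport χ).eq_empty_or_nonempty with he | hne
  · refine ⟨0, fun t => ?_⟩
    have h1 : χ = 0 := tsupport_eq_empty_iff.1 he
    have h2 : ((0 : 𝓓((⟨Ioo 0 T, isOpen_Ioo⟩ : Opens ℝ), ℝ)) : ℝ → ℝ) = fun _ => 0 := by
      ext; simp
    rw [h1, h2]
    simp
  obtain ⟨a, ha, hal⟩ := hc.isCompact.exists_isLeast hne
  obtain ⟨b, hb, hbl⟩ := hc.isCompact.exists_isGreatest hne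
  have hz : ∀ t, t ∉ Icc a b → χ t = 0 := fun t ht =>
    image_eq_zero_of_notMem_tsupport fun h => ht ⟨hal h, hbl h⟩
  have hder : ∀ t, HasDerivAt (fun u => ∫ s in (0 : ℝ)..u, χ s) (χ t) t := fun t =>
    intervalIntegral.integral_hasDerivAt_right (hχ.continuous.intervalIntegrable _ _)
      (hχ.continuous.stronglyMeasurableAtFilter _ _) hχ.continuous.continuousAt
  have hsupp : Function.support (fun u => ∫ s in (0 : ℝ)..u, χ s) ⊆ Icc a b := by
    intro t ht
    by_contra hn
    refine ht ?_
    have ha0 : 0 < a := (hs ha).1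
    by_cases hta : a ≤ t
    · have htb : b < t := by
        by_contra h
        exact hn ⟨hta, not_lt.1 h⟩
      change ∫ s in (0 : ℝ)..t, χ s = 0
      rw [intervalIntegral.integral_eq_integral_of_support_subset, h0]
      intro s hs'
      have : s ∈ Icc a b := by
        by_contra h
        exact hs' (hz s h)
      exact ⟨ha0.trans_le this.1, this.2.trans htb.le⟩
    · refine (intervalIntegral.integral_congr (g := fun _ => 0) fun s hs' => ?_).trans (by simp)
      refine hz s fun h => ?_
      rcases mem_uIcc.1 hs' with h2 | h2
      · exact hta (h.1.trans h2.2)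
      · linarith [h.1, h2.2]
  refine ⟨⟨fun u => ∫ s in (0 : ℝ)..u, χ s, ?_, ?_, ?_⟩, fun t => (hder t).deriv⟩
  · refine contDiff_infty_iff_deriv.2 ⟨fun t => (hder t).differentiableAt, ?_⟩
    rwa [show deriv (fun u => ∫ s in (0 : ℝ)..u, χ s) = χ from funext fun t => (hder t).deriv]
  · exact HasCompactSupport.of_support_subset_isCompact isCompact_Icc hsupp
  · exact (closure_minimal hsupp isClosed_Icc).trans (Icc_subset_Ioo (hs ha).1 (hs hb).2)

/-- If `u` has vanishing weak derivative, then `∫ g u = (∫ g) ∫ ρ u` for a weight `ρ` of integral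
one, since `g - (∫ g) ρ` is a derivative. -/
theorem integral_smul_eq_of_integral_deriv_smul_eq_zero {u : ℝ → W}
    (hu : Integrable u (volume.restrict (Ioo 0 T)))
    (h : ∀ ψ : 𝓓((⟨Ioo 0 T, isOpen_Ioo⟩ : Opens ℝ), ℝ), ∫ t in Ioo 0 T, deriv ψ t • u t = 0)
    {ρ g : ℝ → ℝ} (hρ : ContDiff ℝ ((⊤ : ℕ∞) : WithTop ℕ∞) ρ) (hρc : HasCompactSupport ρ)
    (hρs : tsupport ρ ⊆ Ioo 0 T) (hρ1 : ∫ t, ρ t = 1)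
    (hg : ContDiff ℝ ((⊤ : ℕ∞) : WithTop ℕ∞) g) (hgc : HasCompactSupport g)
    (hgs : tsupport g ⊆ Ioo 0 T) :
    ∫ t in Ioo 0 T, g t • u t = (∫ t, g t) • ∫ t in Ioo 0 T, ρ t • u t := by
  have hgI : Integrable g volume := hg.continuous.integrable_of_hasCompactSupport hgc
  have hρI : Integrable ρ volume := hρ.continuous.integrable_of_hasCompactSupport hρc
  have hms : tsupport (fun t => (∫ s, g s) • ρ t) ⊆ tsupport ρ :=
    tsupport_smul_subset_right (fun _ => ∫ s, g s) ρ
  have hmc : HasCompactSupport (fun t => (∫ s, g s) • ρ t) :=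
    hρc.smul_left (f := fun _ => ∫ s, g s)
  have hmd : ContDiff ℝ ((⊤ : ℕ∞) : WithTop ℕ∞) (fun t => (∫ s, g s) • ρ t) :=
    hρ.const_smul (∫ s, g s)
  have hmi : Integrable (fun t => (∫ s, g s) • ρ t) volume := hρI.smul (∫ s, g s)
  obtain ⟨ψ, hψ⟩ := exists_testFunction_deriv_eq (T := T)
    (χ := fun t => g t - (∫ s, g s) • ρ t) (hg.sub hmd) (hgc.sub hmc)
    ((tsupport_sub g _).trans (union_subset hgs (hms.trans hρs)))
    (by
      rw [integral_sub hgI hmi, integral_smul, hρ1]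
      simp)
  have h1 := h ψ
  have h2 : ∀ t, deriv ψ t • u t = g t • u t - (∫ s, g s) • (ρ t • u t) := fun t => by
    rw [hψ, sub_smul, smul_assoc]
  simp_rw [h2] at h1
  have h3 : Integrable (fun t => (∫ s, g s) • (ρ t • u t)) (volume.restrict (Ioo 0 T)) :=
    (hu.smul_of_hasCompactSupport hρ.continuous hρc).smul (∫ s, g s)
  rw [integral_sub (hu.smul_of_hasCompactSupport hg.continuous hgc) h3, integral_smul] at h1
  exact sub_eq_zero.1 h1

/-- The **du Bois-Reymond lemma**: a function on `(0, T)` with vanishing weak derivative is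
constant. -/
theorem exists_ae_eq_const_of_integral_deriv_smul_eq_zero [CompleteSpace W] (hT : 0 < T) {u : ℝ → W}
    (hu : Integrable u (volume.restrict (Ioo 0 T)))
    (h : ∀ ψ : 𝓓((⟨Ioo 0 T, isOpen_Ioo⟩ : Opens ℝ), ℝ), ∫ t in Ioo 0 T, deriv ψ t • u t = 0) :
    ∃ c : W, ∀ᵐ t ∂(volume.restrict (Ioo 0 T)), u t = c := by
  obtain ⟨ρ, hρ, hρc, hρs, hρ1⟩ := exists_contDiff_integral_eq_one hT
  -- the constant is the mean of `u` with respect to the weight `ρ`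
  refine ⟨∫ t in Ioo 0 T, ρ t • u t, ?_⟩
  have hloc : LocallyIntegrableOn (fun t => u t - ∫ t in Ioo 0 T, ρ t • u t) (Ioo 0 T)
      (volume.restrict (Ioo 0 T)) :=
    (hu.sub (integrable_const _)).locallyIntegrable.locallyIntegrableOn _
  have key := isOpen_Ioo.ae_eq_zero_of_integral_contDiff_smul_eq_zero hloc
    (fun g hg hgc hgs => by
      have h2 : ∫ t in Ioo 0 T, g t = ∫ t, g t :=
        setIntegral_eq_integral_of_forall_compl_eq_zero fun x hx =>
          image_eq_zero_of_notMem_tsupport fun h => hx (hgs h)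
      have hgI : Integrable g (volume.restrict (Ioo 0 T)) :=
        (hg.continuous.integrable_of_hasCompactSupport hgc).restrict
      simp_rw [smul_sub]
      rw [integral_sub (hu.smul_of_hasCompactSupport hg.continuous hgc) (hgI.smul_const _),
        integral_smul_const, h2,
        integral_smul_eq_of_integral_deriv_smul_eq_zero hu h hρ hρc hρs hρ1 hg hgc hgs, sub_self])
  filter_upwards [key, ae_restrict_mem measurableSet_Ioo] with t h1 h2
  exact sub_eq_zero.1 (h1 h2)

end WeakTimeDerivative

/-! ### Weak solutions of the abstract evolution equation -/

section WeakSolutions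

variable {V H : Type*} [NormedAddCommGroup V] [InnerProductSpace ℝ V]
  [NormedAddCommGroup H] [InnerProductSpace ℝ H] {T : ℝ}

/-- Weak solutions of `(i† i B)' + A B = F`, `i B(0) = B₀` in the sense of the triple
`V → H → V'` given by `i`, where `A` represents a bilinear form on `V` by Riesz, with
`B ∈ L²(0, T; V)`, `B' ∈ L²(0, T; V')` and `i B ∈ C([0, T]; H)`. -/
def IsEvolutionSolution (i : V →L[ℝ] H) (A : V →L[ℝ] V) (F : ℝ → StrongDual ℝ V) (B₀ : H)
    (B : Lp V 2 ((volume : Measure ℝ).restrict (Ioo 0 T))) : Prop :=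
  (∃ B' : Lp (StrongDual ℝ V) 2 ((volume : Measure ℝ).restrict (Ioo 0 T)),
    (∀ ψ : 𝓓((⟨Ioo 0 T, isOpen_Ioo⟩ : Opens ℝ), ℝ),
      ∫ t in Ioo 0 T, deriv ψ t • (innerSL ℝ (i (B t))).comp i = -∫ t in Ioo 0 T, ψ t • B' t) ∧
    ∀ v : V, ∀ᵐ t ∂(volume.restrict (Ioo 0 T)), B' t v + ⟪A (B t), v⟫_ℝ = F t v) ∧
  ∃ b : ℝ → H, ContinuousOn b (Icc 0 T) ∧ b 0 = B₀ ∧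
    ∀ᵐ t ∂(volume.restrict (Ioo 0 T)), b t = i (B t)

variable [CompleteSpace V] [CompleteSpace H]

/-- The map `H → V'`, `g ↦ (g, i ·)`, as a continuous map. It is conjugate-linear only in the
formal sense of Mathlib's Riesz isomorphism. -/
noncomputable def pairingCLM (i : V →L[ℝ] H) : H →SL[starRingEnd ℝ] StrongDual ℝ V :=
  ((InnerProductSpace.toDual ℝ V).toContinuousLinearEquiv :
    V →SL[starRingEnd ℝ] StrongDual ℝ V).comp i.adjoint

theorem pairingCLM_apply (i : V →L[ℝ] H) (g : H) : pairingCLM i g = (innerSL ℝ g).comp i := by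
  ext v
  change ⟪i.adjoint g, v⟫_ℝ = ⟪g, i v⟫_ℝ
  rw [ContinuousLinearMap.adjoint_inner_left]

/-- The Riesz isomorphism `V' → V`, as a continuous map. -/
noncomputable def rieszCLM (V : Type*) [NormedAddCommGroup V] [InnerProductSpace ℝ V]
    [CompleteSpace V] : StrongDual ℝ V →SL[starRingEnd ℝ] V :=
  (InnerProductSpace.toDual ℝ V).symm.toContinuousLinearEquiv

theorem inner_rieszCLM (ℓ : StrongDual ℝ V) (v : V) : ⟪rieszCLM V ℓ, v⟫_ℝ = ℓ v :=
  InnerProductSpace.toDual_symm_apply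

/-- The identity for the weak time derivative, tested with an element of `V`. -/
theorem integral_deriv_smul_pairing_iff (i : V →L[ℝ] H)
    (B : Lp V 2 ((volume : Measure ℝ).restrict (Ioo 0 T)))
    (B' : Lp (StrongDual ℝ V) 2 ((volume : Measure ℝ).restrict (Ioo 0 T)))
    (ψ : 𝓓((⟨Ioo 0 T, isOpen_Ioo⟩ : Opens ℝ), ℝ)) :
    ∫ t in Ioo 0 T, deriv ψ t • (innerSL ℝ (i (B t))).comp i = -∫ t in Ioo 0 T, ψ t • B' t ↔
      ∀ v, ∫ t in Ioo 0 T, deriv ψ t * ⟪i (B t), i v⟫_ℝ = -∫ t in Ioo 0 T, ψ t * B' t v := by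
  refine ContinuousLinearMap.ext_iff.trans (forall_congr' fun v => ?_)
  have h1 : Integrable (fun t => (innerSL ℝ (i (B t))).comp i) (volume.restrict (Ioo 0 T)) := by
    simp_rw [← pairingCLM_apply]
    exact memLp_one_iff_integrable.1 (((pairingCLM i).comp i).comp_memLp'
      ((Lp.memLp B).mono_exponent one_le_two))
  rw [neg_apply, ContinuousLinearMap.integral_apply (integrable_deriv_testFunction_smul ψ h1),
    ContinuousLinearMap.integral_apply
      (integrable_testFunction_smul ψ (integrable_coeFn_Lp_two B'))]
  rfl

variable {i : V →L[ℝ] H} {A : V →L[ℝ] V} {c : ℝ} {B₀ : H}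
  {F : Lp (StrongDual ℝ V) 2 ((volume : Measure ℝ).restrict (Ioo 0 T))}
  {B : Lp V 2 ((volume : Measure ℝ).restrict (Ioo 0 T))}

/-- The evolution equation integrated in time, `i† b(t) + ∫₀ᵗ A B = i† B₀ + ∫₀ᵗ f` for
`t ∈ [0, T]`, where `b` is the continuous representative of `i B`. -/
def IsIntegratedSolution (i : V →L[ℝ] H) (A : V →L[ℝ] V)
    (f : Lp V 2 ((volume : Measure ℝ).restrict (Ioo 0 T))) (B₀ : H)
    (B : Lp V 2 ((volume : Measure ℝ).restrict (Ioo 0 T))) (b : ℝ → H) : Prop :=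
  ContinuousOn b (Icc 0 T) ∧ b 0 = B₀ ∧
    (∀ᵐ t ∂(volume.restrict (Ioo 0 T)), b t = i (B t)) ∧
    ∀ t ∈ Icc 0 T, i.adjoint (b t) +
      primitive (volume.restrict (Ioo 0 T)) (fun s => A (B s)) t =
        i.adjoint B₀ + primitive (volume.restrict (Ioo 0 T)) f t

/-- A function with weak derivative `w` is the primitive of `w` up to a constant, by the
du Bois-Reymond lemma; the initial value fixes the constant. -/
theorem IsEvolutionSolution.exists_isIntegratedSolution (hT : 0 < T)
    (h : IsEvolutionSolution i A (fun t => F t) B₀ B) :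
    ∃ b, IsIntegratedSolution i A ((rieszCLM V).compLp F) B₀ B b := by
  obtain ⟨⟨B', hB', heq⟩, b, hbc, hb0, hb⟩ := h
  refine ⟨b, hbc, hb0, hb, ?_⟩
  set f := (rieszCLM V).compLp F
  have hfF : ∀ᵐ t ∂(volume.restrict (Ioo 0 T)), f t = rieszCLM V (F t) :=
    (rieszCLM V).coeFn_compLp F
  have hf1 : Integrable f (volume.restrict (Ioo 0 T)) := integrable_coeFn_Lp_two f
  have hAB : Integrable (fun t => A (B t)) (volume.restrict (Ioo 0 T)) :=
    A.integrable_comp (integrable_coeFn_Lp_two B)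
  have hg : Integrable (fun t => f t - A (B t)) (volume.restrict (Ioo 0 T)) := hf1.sub hAB
  have hbi : Integrable (fun t => i.adjoint (b t)) (volume.restrict (Ioo 0 T)) := by
    refine ((i.adjoint ∘L i).integrable_comp (integrable_coeFn_Lp_two B)).congr ?_
    filter_upwards [hb] with t ht
    rw [ht]
    rfl
  have hpc := continuous_primitive_of_integrable hg
  have hpi := integrable_primitive hg
  -- the integrated equation says that `u` is constant
  set u : ℝ → V := fun t =>
    i.adjoint (b t) - primitive (volume.restrict (Ioo 0 T)) (fun t => f t - A (B t)) t with hu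
  have hweak : ∀ ψ : 𝓓((⟨Ioo 0 T, isOpen_Ioo⟩ : Opens ℝ), ℝ),
      ∫ t in Ioo 0 T, deriv ψ t • u t = 0 := by
    intro ψ
    have h1 : ∫ t in Ioo 0 T, deriv ψ t • i.adjoint (b t) =
        -∫ t in Ioo 0 T, ψ t • (f t - A (B t)) := by
      refine ext_inner_left ℝ fun v => ?_
      rw [inner_neg_right]
      have e1 := (innerSL ℝ v).integral_comp_comm (integrable_deriv_testFunction_smul ψ hbi)
      have e2 := (innerSL ℝ v).integral_comp_comm (integrable_testFunction_smul ψ hg)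
      refine e1.symm.trans (Eq.trans ?_ (congrArg Neg.neg e2))
      refine Eq.trans ?_ (((integral_deriv_smul_pairing_iff i B B' ψ).1 (hB' ψ) v).trans
        (congrArg Neg.neg ?_))
      · refine integral_congr_ae ?_
        filter_upwards [hb] with t ht
        change ⟪v, deriv ψ t • i.adjoint (b t)⟫_ℝ = _
        rw [inner_smul_right, ContinuousLinearMap.adjoint_inner_right, ht, real_inner_comm]
      · refine integral_congr_ae ?_
        filter_upwards [heq v, hfF] with t ht hft
        change _ = ⟪v, ψ t • (f t - A (B t))⟫_ℝ
        rw [inner_smul_right, real_inner_comm, inner_sub_left, hft, inner_rieszCLM, ← ht,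
          add_sub_cancel_right]
    have h2 := integral_deriv_smul_primitive ψ hg
    simp only [hu, smul_sub]
    rw [integral_sub (integrable_deriv_testFunction_smul ψ hbi)
      (integrable_deriv_testFunction_smul ψ hpi), h2]
    exact sub_eq_zero.2 h1
  obtain ⟨c, hc⟩ := exists_ae_eq_const_of_integral_deriv_smul_eq_zero hT (hbi.sub hpi) hweak
  have hIcc : EqOn u (fun _ => c) (Icc 0 T) := by
    refine Measure.eqOn_Icc_of_ae_eq volume hT.ne ?_ ?_ continuousOn_const
    · rw [← restrict_Ioo_eq_restrict_Icc]
      exact hc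
    · exact ((ContinuousLinearMap.continuous _).comp_continuousOn hbc).sub hpc.continuousOn
  intro t ht
  have h0 : u 0 = c := hIcc (left_mem_Icc.2 hT.le)
  have ht' : u t = c := hIcc ht
  have hsub := primitive_sub hf1 hAB t
  rw [← h0] at ht'
  simp only [hu, hsub, primitive_restrict_Ioo_zero, hb0, sub_zero] at ht'
  rw [← ht']
  abel

/-- The weak time derivative of an integrated solution is `F - A B`, as an element of
`L²(0, T; V')`. -/
theorem IsIntegratedSolution.isEvolutionSolution {b : ℝ → H}
    (h : IsIntegratedSolution i A ((rieszCLM V).compLp F) B₀ B b) :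
    IsEvolutionSolution i A (fun t => F t) B₀ B := by
  obtain ⟨hbc, hb0, hb, heq⟩ := h
  refine ⟨?_, b, hbc, hb0, hb⟩
  set f := (rieszCLM V).compLp F
  have hfF : ∀ᵐ t ∂(volume.restrict (Ioo 0 T)), f t = rieszCLM V (F t) :=
    (rieszCLM V).coeFn_compLp F
  have hf1 : Integrable f (volume.restrict (Ioo 0 T)) := integrable_coeFn_Lp_two f
  have hAB : Integrable (fun t => A (B t)) (volume.restrict (Ioo 0 T)) :=
    A.integrable_comp (integrable_coeFn_Lp_two B)
  have hg : Integrable (fun t => f t - A (B t)) (volume.restrict (Ioo 0 T)) := hf1.sub hAB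
  let J : V →SL[starRingEnd ℝ] StrongDual ℝ V :=
    (InnerProductSpace.toDual ℝ V).toContinuousLinearEquiv
  have hB'ae : ∀ᵐ t ∂(volume.restrict (Ioo 0 T)), ∀ v,
      (F - (J.comp A).compLp B) t v = F t v - ⟪A (B t), v⟫_ℝ := by
    filter_upwards [Lp.coeFn_sub F ((J.comp A).compLp B), (J.comp A).coeFn_compLp B]
      with t h1 h2 v
    rw [h1, Pi.sub_apply, h2]
    rfl
  refine ⟨F - (J.comp A).compLp B, fun ψ =>
    (integral_deriv_smul_pairing_iff i B _ ψ).2 fun v => ?_, fun v => ?_⟩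
  · have hsub := primitive_sub hf1 hAB
    have hpi := integrable_primitive hg
    have h1 : ∀ᵐ t ∂(volume.restrict (Ioo 0 T)), deriv ψ t * ⟪i (B t), i v⟫_ℝ =
        ⟪v, deriv ψ t • primitive (volume.restrict (Ioo 0 T)) (fun t => f t - A (B t)) t⟫_ℝ +
          deriv ψ t * ⟪v, i.adjoint B₀⟫_ℝ := by
      filter_upwards [hb, ae_restrict_mem measurableSet_Ioo] with t ht htI
      have h2 := heq t (Ioo_subset_Icc_self htI)
      have h3 : primitive (volume.restrict (Ioo 0 T)) (fun t => f t - A (B t)) t =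
          i.adjoint (b t) - i.adjoint B₀ := by
        rw [hsub, sub_eq_sub_iff_add_eq_add, add_comm, ← h2]
      rw [h3, inner_smul_right, inner_sub_right, ← ht, ContinuousLinearMap.adjoint_inner_right,
        real_inner_comm]
      ring
    have i1 : Integrable (fun t => ⟪v, deriv ψ t •
        primitive (volume.restrict (Ioo 0 T)) (fun t => f t - A (B t)) t⟫_ℝ)
        (volume.restrict (Ioo 0 T)) :=
      (integrable_deriv_testFunction_smul ψ hpi).const_inner (𝕜 := ℝ) v
    have i2 : Integrable (fun t => deriv ψ t * ⟪v, i.adjoint B₀⟫_ℝ) (volume.restrict (Ioo 0 T)) :=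
      integrable_deriv_testFunction_smul ψ (integrable_const _)
    rw [integral_congr_ae h1, integral_add i1 i2, integral_mul_const,
      integral_deriv_testFunction, zero_mul, add_zero]
    refine ((innerSL ℝ v).integral_comp_comm (integrable_deriv_testFunction_smul ψ hpi)).trans ?_
    rw [integral_deriv_smul_primitive ψ hg, map_neg]
    refine congrArg Neg.neg
      (((innerSL ℝ v).integral_comp_comm (integrable_testFunction_smul ψ hg)).symm.trans ?_)
    refine integral_congr_ae ?_
    filter_upwards [hB'ae, hfF] with t ht hft
    change ⟪v, ψ t • (f t - A (B t))⟫_ℝ = _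
    rw [ht, inner_smul_right, real_inner_comm, inner_sub_left, hft, inner_rieszCLM]
  · filter_upwards [hB'ae] with t ht
    rw [ht, sub_add_cancel]

/-- If the data vanish on a set `N` of test elements annihilated by `A`, so does the solution: test
the integrated equation with the elements of `N`. -/
theorem IsIntegratedSolution.forall_inner_eq_zero {b : ℝ → H}
    (h : IsIntegratedSolution i A ((rieszCLM V).compLp F) B₀ B b) {N : Set V}
    (hN : ∀ v ∈ N, ∀ u, ⟪A u, v⟫_ℝ = 0) (hB₀ : ∀ v ∈ N, ⟪B₀, i v⟫_ℝ = 0)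
    (hF : ∀ᵐ t ∂(volume.restrict (Ioo 0 T)), ∀ v ∈ N, F t v = 0) :
    ∀ᵐ t ∂(volume.restrict (Ioo 0 T)), ∀ v ∈ N, ⟪i (B t), i v⟫_ℝ = 0 := by
  obtain ⟨-, -, hb, heq⟩ := h
  filter_upwards [hb, ae_restrict_mem measurableSet_Ioo] with t ht htI v hv
  have h1 := congrArg (fun z => ⟪v, z⟫_ℝ) (heq t (Ioo_subset_Icc_self htI))
  simp only [inner_add_right, ContinuousLinearMap.adjoint_inner_right] at h1
  have h2 : ⟪v, primitive (volume.restrict (Ioo 0 T)) (fun s => A (B s)) t⟫_ℝ = 0 := by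
    refine ((innerSL ℝ v).primitive_comp
      (A.integrable_comp (integrable_coeFn_Lp_two B)) t).symm.trans ?_
    refine integral_eq_zero_of_ae (Filter.Eventually.of_forall fun s => ?_)
    exact (real_inner_comm _ _).trans (hN v hv (B s))
  have h3 : ⟪v, primitive (volume.restrict (Ioo 0 T)) ((rieszCLM V).compLp F) t⟫_ℝ = 0 := by
    refine ((innerSL ℝ v).primitive_comp (integrable_coeFn_Lp_two _) t).symm.trans ?_
    refine integral_eq_zero_of_ae (ae_restrict_of_ae ?_)
    filter_upwards [hF, (rieszCLM V).coeFn_compLp F] with s hs hfs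
    change ⟪v, (rieszCLM V).compLp F s⟫_ℝ = 0
    rw [hfs, real_inner_comm, inner_rieszCLM, hs v hv]
  rw [h2, h3, add_zero, add_zero, real_inner_comm, real_inner_comm B₀, hB₀ v hv, ht] at h1
  exact h1

theorem existsUnique_isEvolutionSolution (hT : 0 < T) (hi : Function.Injective i)
    (hdense : DenseRange i) (hA : ∀ u v, ⟪A u, v⟫_ℝ = ⟪A v, u⟫_ℝ) (hA0 : ∀ u, 0 ≤ ⟪A u, u⟫_ℝ)
    (hc0 : 0 < c) (hc : ∀ u, c * ‖u‖ ^ 2 ≤ ⟪A u, u⟫_ℝ + ‖i u‖ ^ 2)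
    (F : Lp (StrongDual ℝ V) 2 ((volume : Measure ℝ).restrict (Ioo 0 T))) (B₀ : H) :
    ∃! B : Lp V 2 ((volume : Measure ℝ).restrict (Ioo 0 T)),
      IsEvolutionSolution i A (fun t => F t) B₀ B := by
  refine existsUnique_of_exists_of_unique ?_ ?_
  · obtain ⟨B, b, hb, heq⟩ := exists_integrated_solution (volume.restrict (Ioo 0 T)) hi hdense
      hA hA0 hc0 hc ((rieszCLM V).compLp F) B₀
    have hb0 : b 0 = B₀ := by
      have h0 := heq 0
      rw [primitive_restrict_Ioo_zero, primitive_restrict_Ioo_zero, add_zero, add_zero] at h0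
      refine sub_eq_zero.1 (hdense.eq_zero_of_inner_left ℝ fun v => ?_)
      rw [← ContinuousLinearMap.adjoint_inner_left, map_sub, h0, sub_self, inner_zero_left]
    exact ⟨B, IsIntegratedSolution.isEvolutionSolution
      ⟨b.continuous.continuousOn, hb0, hb, fun t _ => heq t⟩⟩
  · intro B₁ B₂ h₁ h₂
    obtain ⟨b₁, -, -, hb₁, heq₁⟩ := h₁.exists_isIntegratedSolution hT
    obtain ⟨b₂, -, -, hb₂, heq₂⟩ := h₂.exists_isIntegratedSolution hT
    refine sub_eq_zero.1 (eq_zero_of_integrated_equation (volume.restrict (Ioo 0 T)) hi hA hA0 _ ?_)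
    filter_upwards [hb₁, hb₂, Lp.coeFn_sub B₁ B₂, ae_restrict_mem measurableSet_Ioo]
      with t h1 h2 h3 htI
    have hp : primitive (volume.restrict (Ioo 0 T)) (fun s => A ((B₁ - B₂) s)) t =
        primitive (volume.restrict (Ioo 0 T)) (fun s => A (B₁ s)) t -
          primitive (volume.restrict (Ioo 0 T)) (fun s => A (B₂ s)) t := by
      rw [← primitive_sub (A.integrable_comp (integrable_coeFn_Lp_two B₁))
        (A.integrable_comp (integrable_coeFn_Lp_two B₂))]
      refine primitive_congr ?_ t
      filter_upwards [Lp.coeFn_sub B₁ B₂] with s hs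
      rw [hs, Pi.sub_apply, map_sub]
    have e1 := heq₁ t (Ioo_subset_Icc_self htI)
    have e2 := heq₂ t (Ioo_subset_Icc_self htI)
    rw [h3, Pi.sub_apply, map_sub, map_sub, ← h1, ← h2, hp, sub_add_sub_comm, e1, e2, sub_self]

/-- `L²(0, T; H) → L²(0, T; V')`. -/
theorem exists_Lp_pairing (i : V →L[ℝ] H)
    (F : Lp H 2 ((volume : Measure ℝ).restrict (Ioo 0 T))) :
    ∃ G : Lp (StrongDual ℝ V) 2 ((volume : Measure ℝ).restrict (Ioo 0 T)),
      (fun t => (innerSL ℝ (F t)).comp i) =ᵐ[volume.restrict (Ioo 0 T)] G := by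
  refine ⟨(pairingCLM i).compLp F, ?_⟩
  filter_upwards [(pairingCLM i).coeFn_compLp F] with t ht
  rw [ht, pairingCLM_apply]

/-- The Riesz representative of the form `(u, v) ↦ (M D u, D v)`. -/
theorem exists_operator_of_form (D : V →L[ℝ] H) (M : H →L[ℝ] H) :
    ∃ A : V →L[ℝ] V, ∀ u v, ⟪A u, v⟫_ℝ = ⟪M (D u), D v⟫_ℝ :=
  ⟨D.adjoint ∘L M ∘L D, fun u v => by
    rw [ContinuousLinearMap.comp_apply, ContinuousLinearMap.adjoint_inner_left,
      ContinuousLinearMap.comp_apply]⟩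

end WeakSolutions

/-! ### The curl-curl equation -/

section CurlCurl

variable {Ω : Opens E3} {β : E3 → ℝ} {β₀ βM : ℝ}

/-- Multiplication by an essentially bounded function is a bounded operator on `L²(Ω)³`. -/
theorem exists_mul_operator (hβ : AEMeasurable β (volume.restrict (Ω : Set E3)))
    (hb : ∀ᵐ x ∂(volume.restrict (Ω : Set E3)), |β x| ≤ βM) :
    ∃ M : L2Field Ω →L[ℝ] L2Field Ω, ∀ g : L2Field Ω,
      ∀ᵐ x ∂(volume.restrict (Ω : Set E3)), M g x = β x • g x := by
  have hle : ∀ g : L2Field Ω, ∀ᵐ x ∂(volume.restrict (Ω : Set E3)),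
      ‖β x • g x‖ ≤ βM * ‖g x‖ := fun g => by
    filter_upwards [hb] with x hx
    rw [norm_smul]
    exact mul_le_mul_of_nonneg_right hx (norm_nonneg _)
  have hmem : ∀ g : L2Field Ω, MemLp (fun x => β x • g x) 2 (volume.restrict (Ω : Set E3)) :=
    fun g => (Lp.memLp g).of_le_mul
      (hβ.aestronglyMeasurable.smul (Lp.aestronglyMeasurable g)) (hle g)
  refine ⟨LinearMap.mkContinuous
    { toFun := fun g => (hmem g).toLp _
      map_add' := fun f g => Lp.ext (by
        filter_upwards [(hmem (f + g)).coeFn_toLp, (hmem f).coeFn_toLp, (hmem g).coeFn_toLp,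
          Lp.coeFn_add f g, Lp.coeFn_add ((hmem f).toLp _) ((hmem g).toLp _)] with x h1 h2 h3 h4 h5
        rw [h1, h5, Pi.add_apply, h2, h3, h4, Pi.add_apply, smul_add])
      map_smul' := fun r g => Lp.ext (by
        filter_upwards [(hmem (r • g)).coeFn_toLp, (hmem g).coeFn_toLp,
          Lp.coeFn_smul r g, Lp.coeFn_smul r ((hmem g).toLp _)] with x h1 h2 h3 h4
        rw [h1, RingHom.id_apply, h4, Pi.smul_apply, h2, h3, Pi.smul_apply, smul_comm]) }
    βM fun g => Lp.norm_le_mul_norm_of_ae_le_mul (by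
      filter_upwards [(hmem g).coeFn_toLp, hle g] with x h1 h2
      change ‖(hmem g).toLp _ x‖ ≤ _
      rwa [h1]), fun g => (hmem g).coeFn_toLp⟩

theorem norm_sq_HCurlZero (v : HCurlZero Ω) : ‖v‖ ^ 2 = ‖toField v‖ ^ 2 + ‖curl v‖ ^ 2 :=
  WithLp.prod_norm_sq_eq_of_L2 (v : WithLp 2 (L2Field Ω × L2Field Ω))

/-- The Riesz representative on `H₀(curl; Ω)` of the form `(u, v) ↦ (β ∇ × u, ∇ × v)`. -/
theorem exists_curlCurl_operator (hβ : AEMeasurable β (volume.restrict (Ω : Set E3)))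
    (hβ₀ : 0 < β₀)
    (hbound : ∀ᵐ x ∂(volume.restrict (Ω : Set E3)), β₀ ≤ β x ∧ β x ≤ βM) :
    ∃ A : HCurlZero Ω →L[ℝ] HCurlZero Ω,
      (∀ u v, ⟪A u, v⟫_ℝ = ∫ x in (Ω : Set E3), β x * inner ℝ (curl u x) (curl v x)) ∧
      (∀ u v, ⟪A u, v⟫_ℝ = ⟪A v, u⟫_ℝ) ∧ (∀ u, 0 ≤ ⟪A u, u⟫_ℝ) ∧
      ∀ u, min β₀ 1 * ‖u‖ ^ 2 ≤ ⟪A u, u⟫_ℝ + ‖toField u‖ ^ 2 := by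
  obtain ⟨M, hM⟩ := exists_mul_operator (βM := βM) hβ (by
    filter_upwards [hbound] with x hx
    rw [abs_of_nonneg (hβ₀.le.trans hx.1)]
    exact hx.2)
  have hMform : ∀ f g : L2Field Ω, ⟪M f, g⟫_ℝ =
      ∫ x in (Ω : Set E3), β x * inner ℝ (f x) (g x) := by
    intro f g
    rw [L2.inner_def]
    refine integral_congr_ae ?_
    filter_upwards [hM f] with x hx
    rw [hx, real_inner_smul_left]
  have hMlow : ∀ f : L2Field Ω, β₀ * ‖f‖ ^ 2 ≤ ⟪M f, f⟫_ℝ := by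
    intro f
    rw [← real_inner_self_eq_norm_sq, L2.inner_def, L2.inner_def, ← integral_const_mul]
    refine integral_mono_ae ((L2.integrable_inner (𝕜 := ℝ) f f).const_mul _)
      (L2.integrable_inner (𝕜 := ℝ) (M f) f) ?_
    filter_upwards [hbound, hM f] with x hx hMx
    rw [hMx, real_inner_smul_left]
    exact mul_le_mul_of_nonneg_right hx.1 real_inner_self_nonneg
  have hMsymm : ∀ f g : L2Field Ω, ⟪M f, g⟫_ℝ = ⟪M g, f⟫_ℝ := by
    intro f g
    rw [hMform, hMform]
    exact integral_congr_ae (Filter.Eventually.of_forall fun x =>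
      congrArg (β x * ·) (real_inner_comm _ _))
  obtain ⟨A, hA⟩ := exists_operator_of_form (curl (Ω := Ω)) M
  refine ⟨A, fun u v => (hA u v).trans (hMform _ _), fun u v => ?_, fun u => ?_, fun u => ?_⟩
  · rw [hA, hA, hMsymm]
  · rw [hA]
    exact le_trans (by positivity) (hMlow (curl u))
  · have h1 := hMlow (curl u)
    have h2 : min β₀ 1 * ‖toField u‖ ^ 2 ≤ 1 * ‖toField u‖ ^ 2 :=
      mul_le_mul_of_nonneg_right (min_le_right _ _) (by positivity)
    have h3 : min β₀ 1 * ‖curl u‖ ^ 2 ≤ β₀ * ‖curl u‖ ^ 2 :=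
      mul_le_mul_of_nonneg_right (min_le_left _ _) (by positivity)
    rw [norm_sq_HCurlZero, hA]
    linarith

variable {T : ℝ}

theorem isWeakSolution_iff {A : HCurlZero Ω →L[ℝ] HCurlZero Ω}
    (hA : ∀ u v, ⟪A u, v⟫_ℝ = ∫ x in (Ω : Set E3), β x * inner ℝ (curl u x) (curl v x))
    {F : ℝ → HCurlZeroDual Ω} {B₀ : L2Field Ω} {B : BochnerL2 T (HCurlZero Ω)} :
    IsWeakSolution Ω β T F B₀ B ↔ IsEvolutionSolution toField A F B₀ B := by
  unfold IsEvolutionSolution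
  simp only [hA]
  exact Iff.rfl

theorem exists_Lp_fieldToDual (F : BochnerL2 T (L2Field Ω)) :
    ∃ G : BochnerL2 T (HCurlZeroDual Ω),
      ∀ᵐ t ∂(volume.restrict (Ioo 0 T)), fieldToDual (F t) = G t :=
  exists_Lp_pairing (toField (Ω := Ω)) F

theorem IsWeakSolution.congr {F G : ℝ → HCurlZeroDual Ω} {B₀ : L2Field Ω}
    {B : BochnerL2 T (HCurlZero Ω)} (hFG : ∀ᵐ t ∂(volume.restrict (Ioo 0 T)), F t = G t)
    (h : IsWeakSolution Ω β T F B₀ B) : IsWeakSolution Ω β T G B₀ B := by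
  obtain ⟨⟨B', hB', heq⟩, hb⟩ := h
  refine ⟨⟨B', hB', fun v => ?_⟩, hb⟩
  filter_upwards [heq v, hFG] with t h1 h2
  rw [h1, h2]

theorem inner_toField_testGradient (g : L2Field Ω) (φ : 𝓓(Ω, ℝ)) :
    ⟪g, toField (testFieldHCurl (testGradient φ))⟫_ℝ =
      ∫ x in (Ω : Set E3), inner ℝ (g x) (gradient φ x) := by
  rw [L2.inner_def, toField_testFieldHCurl]
  refine integral_congr_ae ?_
  filter_upwards [(memLp_testField (testGradient φ)).coeFn_toLp] with x hx
  rw [hx, testGradient_apply]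

theorem IsDivFree.fieldToDual {g : L2Field Ω} (hg : IsDivFree g) :
    IsDivFreeDual (fieldToDual g) := by
  intro φ v hv
  change ⟪g, toField v⟫_ℝ = 0
  rw [L2.inner_def, ← hg φ]
  refine integral_congr_ae ?_
  filter_upwards [hv] with x hx
  rw [hx]

/-- Well-posedness and conservation of the divergence constraint for right-hand sides in
`L²(0, T; H₀(curl; Ω)')`. The constraint is tested with gradients, whose curl vanishes. -/
theorem curlCurl_wellPosed_dual (hβ : AEMeasurable β (volume.restrict (Ω : Set E3)))
    (hβ₀ : 0 < β₀)
    (hbound : ∀ᵐ x ∂(volume.restrict (Ω : Set E3)), β₀ ≤ β x ∧ β x ≤ βM) (hT : 0 < T)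
    (B₀ : L2Field Ω) (F : BochnerL2 T (HCurlZeroDual Ω)) :
    (∃! B : BochnerL2 T (HCurlZero Ω), IsWeakSolution Ω β T (fun t => F t) B₀ B) ∧
      ∀ B : BochnerL2 T (HCurlZero Ω),
        IsWeakSolution Ω β T (fun t => F t) B₀ B →
        IsDivFree B₀ → (∀ᵐ t ∂(volume.restrict (Ioo 0 T)), IsDivFreeDual (F t)) →
        ∀ᵐ t ∂(volume.restrict (Ioo 0 T)), IsDivFree (toField (B t)) := by
  obtain ⟨A, hform, hsymm, hnonneg, hcoer⟩ := exists_curlCurl_operator hβ hβ₀ hbound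
  simp only [isWeakSolution_iff hform]
  refine ⟨existsUnique_isEvolutionSolution hT toField_injective denseRange_toField hsymm hnonneg
    (lt_min hβ₀ one_pos) hcoer F B₀, fun B hB hB₀ hF => ?_⟩
  obtain ⟨b, hb⟩ := hB.exists_isIntegratedSolution hT
  have h := hb.forall_inner_eq_zero
    (N := range fun φ : 𝓓(Ω, ℝ) => testFieldHCurl (testGradient φ)) ?_ ?_ ?_
  · filter_upwards [h] with t ht φ
    rw [← inner_toField_testGradient]
    exact ht _ ⟨φ, rfl⟩
  · rintro _ ⟨φ, rfl⟩ u
    rw [hform, curl_testFieldHCurl_testGradient]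
    refine integral_eq_zero_of_ae ?_
    filter_upwards [Lp.coeFn_zero E3 2 (volume.restrict (Ω : Set E3))] with x hx
    rw [hx]
    simp
  · rintro _ ⟨φ, rfl⟩
    rw [inner_toField_testGradient, hB₀ φ]
  · filter_upwards [hF] with t ht
    rintro _ ⟨φ, rfl⟩
    refine ht φ _ ?_
    rw [toField_testFieldHCurl]
    exact (memLp_testField (testGradient φ)).coeFn_toLp

end CurlCurl

/-- Well-posedness of the linear curl-curl evolution problem, for right-hand sides in
`L²(0, T; L²(Ω)³)` and in `L²(0, T; H₀(curl; Ω)')`, and conservation of the divergence constraint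
when the data are divergence free. -/
theorem mainTheorem1 (Ω : Opens E3) (β : E3 → ℝ)
    (hβ : AEMeasurable β (volume.restrict (Ω : Set E3))) (β₀ βM : ℝ) (hβ₀ : 0 < β₀)
    (hbound : ∀ᵐ x ∂(volume.restrict (Ω : Set E3)), β₀ ≤ β x ∧ β x ≤ βM)
    (T : ℝ) (hT : 0 < T) (B₀ : L2Field Ω) :
    (∀ F : BochnerL2 T (L2Field Ω),
      (∃! B : BochnerL2 T (HCurlZero Ω),
        IsWeakSolution Ω β T (fun t => fieldToDual (F t)) B₀ B) ∧
      ∀ B : BochnerL2 T (HCurlZero Ω),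
        IsWeakSolution Ω β T (fun t => fieldToDual (F t)) B₀ B →
        IsDivFree B₀ → (∀ᵐ t ∂(volume.restrict (Ioo 0 T)), IsDivFree (F t)) →
        ∀ᵐ t ∂(volume.restrict (Ioo 0 T)), IsDivFree (toField (B t))) ∧
    (∀ F : BochnerL2 T (HCurlZeroDual Ω),
      (∃! B : BochnerL2 T (HCurlZero Ω), IsWeakSolution Ω β T (fun t => F t) B₀ B) ∧
      ∀ B : BochnerL2 T (HCurlZero Ω),
        IsWeakSolution Ω β T (fun t => F t) B₀ B →
        IsDivFree B₀ → (∀ᵐ t ∂(volume.restrict (Ioo 0 T)), IsDivFreeDual (F t)) →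
        ∀ᵐ t ∂(volume.restrict (Ioo 0 T)), IsDivFree (toField (B t))) := by
  refine ⟨fun F => ?_, fun F => curlCurl_wellPosed_dual hβ hβ₀ hbound hT B₀ F⟩
  obtain ⟨G, hG⟩ := exists_Lp_fieldToDual F
  have hiff : ∀ B : BochnerL2 T (HCurlZero Ω),
      IsWeakSolution Ω β T (fun t => fieldToDual (F t)) B₀ B ↔
        IsWeakSolution Ω β T (fun t => G t) B₀ B := fun B =>
    ⟨fun h => h.congr hG, fun h => h.congr (hG.mono fun _ => Eq.symm)⟩
  simp only [hiff]
  obtain ⟨hex, hdiv⟩ := curlCurl_wellPosed_dual hβ hβ₀ hbound hT B₀ G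
  refine ⟨hex, fun B hB hB₀ hFdiv => hdiv B hB hB₀ ?_⟩
  filter_upwards [hFdiv, hG] with t h1 h2
  rw [← h2]
  exact h1.fieldToDual
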